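/- Let $M^n$ be a smooth $n$-manifold and $F^n=(M^n,L)$ a Finsler space: $L$ is a smooth, positive, positively $1$-homogeneous function on an open cone $D$ of nonzero tangent vectors whose metric tensor $g_{ij}=\frac12\dot\partial_i\dot\partial_jL^2$ is positive definite ($\dot\partial_i=\partial/\partial y^i$). Let $h_{ij}=L\,\dot\partial_i\dot\partial_jL$, $C_{ijk}=\frac12\dot\partial_kg_{ij}$, and let $(F^i_{jk},G^i_j,C^i_{jk})$ be the Cartan connection of $F^n$, with h- and v-covariant derivatives $X_{i|j}=\partial_jX_i-(\dot\partial_hX_i)G^h_j-F^r_{ij}X_r$ and $X_i|_j=\dot\partial_jX_i-C^r_{ij}X_r$. Let $b_i(x,y)$ be a smooth h-vector on $D$, i.e. $b_i|_k=0$ and $L\,C^h_{ij}b_h=\rho\,h_{ij}$ for some scalar $\rho\neq0$, and suppose that ${}^*L=L^2/(b_iy^i)$ (the Kropina change of $L$) is also a Finsler metric on $D$; put ${}^*F^n=(M^n,{}^*L)$. Let $x^i=x^i(u^\alpha)$ be an immersed hypersurface $M^{n-1}$ of $M^n$, $B^i_\alpha=\partial x^i/\partial u^\alpha$, $B^i_{\alpha\beta}=\partial^2x^i/\partial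 u^\alpha\partial u^\beta$, and let $F^{n-1}$ and ${}^*F^{n-1}$ be $M^{n-1}$ with the metrics induced from $F^n$ and ${}^*F^n$. At a line element $(u,v)$ with $y^i=B^i_\alpha v^\alpha$ in $D$, let $N^i$ be a unit normal of $F^{n-1}$ ($g_{ij}B^i_\alpha N^j=0$, $g_{ij}N^iN^j=1$), put $N_i=g_{ij}N^j$, $H_\alpha=N_i(B^i_{\beta\alpha}v^\beta+G^i_jB^j_\alpha)$ and $H_0=H_\alpha v^\alpha$; let ${}^*H_0$ be the corresponding quantity for ${}^*F^{n-1}$. The hypersurface $F^{n-1}$ is called a hyperplane of the first kind if each of its paths with respect to the induced Cartan connection (whose nonlinear part is $G^\alpha_\beta=B^\alpha_i(B^i_{\gamma\beta}v^\gamma+G^i_jB^j_\beta)$, where $B^\alpha_i=g^{\alpha\beta}g_{ij}B^j_\beta$ and $g^{\alpha\beta}$ is the inverse of the metric tensor of $F^{n-1}$) is also a path of $F^n$; similarly for ${}^*F^{n-1}$. Here a path of a nonlinear connection $\Gamma^i_j$ is a solution of $\ddot c^{\,i}+\Gamma^i_j(c,\dot c)\,\dot c^{\,j}=0$ with $\dot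 c\in D$. Theorem. Suppose that $b_i$ is a gradient, i.e. $b_{i|j}=b_{j|i}$, and is tangent to $F^{n-1}$, i.e. $b_iN^i=0$ at every line element of $F^{n-1}$. Then $F^{n-1}$ is a hyperplane of the first kind if and only if ${}^*F^{n-1}$ is a hyperplane of the first kind. Moreover, $F^{n-1}$ is a hyperplane of the first kind if and only if $H_0=0$ at all its line elements, and ${}^*F^{n-1}$ is a hyperplane of the first kind if and only if ${}^*H_0=0$ at all its line elements. -/

import Mathlib

open scoped Manifold ContDiff Matrix

noncomputable section

namespace FinslerHypersurface

/-! ## Finsler geometry in a coordinate domain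

A scalar on (a part of) the tangent bundle is written in coordinates as a function
`f x y` of the position `x` and the supporting element `y`. -/

section Coordinates

/-- A scalar `f(x, y)` in coordinates. -/
abbrev Scalar (n : ℕ) : Type := (Fin n → ℝ) → (Fin n → ℝ) → ℝ

variable {n m : ℕ}

/-- `∂f/∂xⁱ`. -/
def dX (i : Fin n) (f : Scalar n) (x y : Fin n → ℝ) : ℝ :=
  fderiv ℝ (fun x' => f x' y) x (Pi.single i 1)

/-- `∂f/∂yⁱ`. -/
def dY (i : Fin n) (f : Scalar n) (x y : Fin n → ℝ) : ℝ :=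
  fderiv ℝ (fun y' => f x y') y (Pi.single i 1)

/-- `L²`. -/
def sqL (L : Scalar n) (x y : Fin n → ℝ) : ℝ := L x y ^ 2

/-- The metric tensor `g_ij = ½ ∂²L²/∂yⁱ∂yʲ`. -/
def metric (L : Scalar n) (x y : Fin n → ℝ) : Matrix (Fin n) (Fin n) ℝ :=
  Matrix.of fun i j => (1 / 2) * dY i (dY j (sqL L)) x y

/-- The contravariant metric tensor `g^ij`. -/
def metricInv (L : Scalar n) (x y : Fin n → ℝ) : Matrix (Fin n) (Fin n) ℝ :=
  (metric L x y)⁻¹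

/-- The angular metric tensor `h_ij = L ∂²L/∂yⁱ∂yʲ`. -/
def angular (L : Scalar n) (i j : Fin n) (x y : Fin n → ℝ) : ℝ :=
  L x y * dY i (dY j L) x y

/-- The Cartan tensor `C_ijk = ½ ∂g_ij/∂yᵏ`. -/
def cartanTensor (L : Scalar n) (i j k : Fin n) (x y : Fin n → ℝ) : ℝ :=
  (1 / 2) * dY k (fun x' y' => metric L x' y' i j) x y

/-- `C^r_ij = g^rs C_sij`. -/
def cartanTensorUp (L : Scalar n) (r i j : Fin n) (x y : Fin n → ℝ) : ℝ :=
  ∑ s, metricInv L x y r s * cartanTensor L s i j x y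

/-- `G^i = ¼ g^ir (yˢ ∂²L²/∂yʳ∂xˢ - ∂L²/∂xʳ)`. -/
def sprayCoeff (L : Scalar n) (i : Fin n) (x y : Fin n → ℝ) : ℝ :=
  (1 / 4) * ∑ r, metricInv L x y i r *
    ((∑ s, y s * dY r (dX s (sqL L)) x y) - dX r (sqL L) x y)

/-- The nonlinear connection `G^i_j = ∂G^i/∂yʲ`. -/
def nonlinConn (L : Scalar n) (i j : Fin n) (x y : Fin n → ℝ) : ℝ :=
  dY j (sprayCoeff L i) x y

/-- `δ_j f = ∂f/∂xʲ - G^h_j ∂f/∂yʰ`. -/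
def delta (L : Scalar n) (j : Fin n) (f : Scalar n) (x y : Fin n → ℝ) : ℝ :=
  dX j f x y - ∑ h, nonlinConn L h j x y * dY h f x y

/-- The horizontal coefficients of the Cartan connection,
`F^i_jk = ½ g^ir (δ_j g_rk + δ_k g_jr - δ_r g_jk)`. -/
def cartanConn (L : Scalar n) (i j k : Fin n) (x y : Fin n → ℝ) : ℝ :=
  (1 / 2) * ∑ r, metricInv L x y i r *
    (delta L j (fun x' y' => metric L x' y' r k) x y
      + delta L k (fun x' y' => metric L x' y' j r) x y
      - delta L r (fun x' y' => metric L x' y' j k) x y)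

/-- The h-covariant derivative `X_{i|j} = ∂_j X_i - (∂X_i/∂yʰ) G^h_j - F^r_ij X_r`. -/
def hCov (L : Scalar n) (X : (Fin n → ℝ) → (Fin n → ℝ) → Fin n → ℝ) (i j : Fin n)
    (x y : Fin n → ℝ) : ℝ :=
  dX j (fun x' y' => X x' y' i) x y
    - (∑ h, dY h (fun x' y' => X x' y' i) x y * nonlinConn L h j x y)
    - ∑ r, cartanConn L r i j x y * X x y r

/-- The v-covariant derivative `X_i|_j = ∂X_i/∂yʲ - C^r_ij X_r`. -/
def vCov (L : Scalar n) (X : (Fin n → ℝ) → (Fin n → ℝ) → Fin n → ℝ) (i j : Fin n)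
    (x y : Fin n → ℝ) : ℝ :=
  dY j (fun x' y' => X x' y' i) x y - ∑ r, cartanTensorUp L r i j x y * X x y r

/-- A path of the nonlinear connection `Γ^i_j` on the open interval `(a, b)`: a curve `c` whose
lifts `(c, c')` lie in `D` and which satisfies `c''ⁱ + Γ^i_j(c, c') c'ʲ = 0`. -/
def IsPath (D : Set ((Fin n → ℝ) × (Fin n → ℝ))) (Γ : Fin n → Fin n → Scalar n) (a b : ℝ)
    (c : ℝ → (Fin n → ℝ)) : Prop :=
  ∀ t ∈ Set.Ioo a b,
    DifferentiableAt ℝ c t ∧ (c t, deriv c t) ∈ D ∧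
    HasDerivAt (deriv c)
      (fun i => -∑ j, Γ i j (c t) (deriv c t) * deriv c t j) t

/-! ### Parametrized hypersurfaces `xⁱ = xⁱ(u^α)` (here `X : u ↦ x(u)`) -/

/-- The projection factors `B^i_α = ∂xⁱ/∂u^α`. -/
def proj (X : (Fin m → ℝ) → (Fin n → ℝ)) (u : Fin m → ℝ) : Matrix (Fin n) (Fin m) ℝ :=
  Matrix.of fun i α => fderiv ℝ X u (Pi.single α 1) i

/-- `B^i_αβ = ∂²xⁱ/∂u^α∂u^β`. -/
def proj₂ (X : (Fin m → ℝ) → (Fin n → ℝ)) (u : Fin m → ℝ) (i : Fin n) (α β : Fin m) : ℝ :=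
  fderiv ℝ (fun u' => proj X u' i α) u (Pi.single β 1)

/-- The supporting element `yⁱ = B^i_α v^α` of the ambient space. -/
def support (X : (Fin m → ℝ) → (Fin n → ℝ)) (u v : Fin m → ℝ) : Fin n → ℝ := proj X u *ᵥ v

/-- The metric function of the hypersurface, `(u, v) ↦ L(x(u), y(u, v))`. -/
def inducedL (L : Scalar n) (X : (Fin m → ℝ) → (Fin n → ℝ)) (u v : Fin m → ℝ) : ℝ :=
  L (X u) (support X u v)

/-- `N` is normal to the hypersurface at `(u, v)`: `g_ij B^i_α Nʲ = 0`. -/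
def IsNormal (L : Scalar n) (X : (Fin m → ℝ) → (Fin n → ℝ)) (u v : Fin m → ℝ)
    (N : Fin n → ℝ) : Prop :=
  ∀ α, ∑ i, ∑ j, metric L (X u) (support X u v) i j * proj X u i α * N j = 0

/-- `N` is a unit normal vector at `(u, v)`: normal with `g_ij Nⁱ Nʲ = 1`. -/
def IsUnitNormal (L : Scalar n) (X : (Fin m → ℝ) → (Fin n → ℝ)) (u v : Fin m → ℝ)
    (N : Fin n → ℝ) : Prop :=
  IsNormal L X u v N ∧
    ∑ i, ∑ j, metric L (X u) (support X u v) i j * N i * N j = 1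

/-- `B^i_0α + G^i_j B^j_α`, where `B^i_0α = B^i_βα v^β`. -/
def gaussTerm (L : Scalar n) (X : (Fin m → ℝ) → (Fin n → ℝ)) (i : Fin n) (α : Fin m)
    (u v : Fin m → ℝ) : ℝ :=
  (∑ β, proj₂ X u i β α * v β)
    + ∑ j, nonlinConn L i j (X u) (support X u v) * proj X u j α

/-- The normal curvature vector `H_α = N_i (B^i_0α + G^i_j B^j_α)`, with `N_i = g_ij Nʲ`,
formed with the normal vector `N`. -/
def normalCurvature (L : Scalar n) (X : (Fin m → ℝ) → (Fin n → ℝ)) (N : Fin n → ℝ) (α : Fin m)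
    (u v : Fin m → ℝ) : ℝ :=
  ∑ i, (∑ j, metric L (X u) (support X u v) i j * N j) * gaussTerm L X i α u v

/-- `H_0 = H_α v^α`. -/
def normalCurvature₀ (L : Scalar n) (X : (Fin m → ℝ) → (Fin n → ℝ)) (N : Fin n → ℝ)
    (u v : Fin m → ℝ) : ℝ :=
  ∑ α, normalCurvature L X N α u v * v α

/-- The inverse projection factors `B^α_i = g^αβ g_ij B^j_β`, where `g^αβ` is the inverse of the
metric tensor of the hypersurface. -/
def projInv (L : Scalar n) (X : (Fin m → ℝ) → (Fin n → ℝ)) (α : Fin m) (i : Fin n)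
    (u v : Fin m → ℝ) : ℝ :=
  ∑ β, ∑ j, metricInv (inducedL L X) u v α β
    * metric L (X u) (support X u v) i j * proj X u j β

/-- The nonlinear connection `G^α_β = B^α_i (B^i_0β + G^i_j B^j_β)` of the induced Cartan
connection of the hypersurface. -/
def inducedConn (L : Scalar n) (X : (Fin m → ℝ) → (Fin n → ℝ)) (α β : Fin m)
    (u v : Fin m → ℝ) : ℝ :=
  ∑ i, projInv L X α i u v * gaussTerm L X i β u v

end Coordinates

/-! ## Finsler manifolds -/

section Manifolds

variable {n m : ℕ}
  {M : Type*} [TopologicalSpace M] [ChartedSpace (Fin n → ℝ) M]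
  {S : Type*} [TopologicalSpace S] [ChartedSpace (Fin m → ℝ) S]

/-- The tangent vector of `M` with components `y` at the point with coordinates `x`, in the
preferred chart at `p`. -/
def coordVec (p : M) (x y : Fin n → ℝ) : TangentBundle 𝓘(ℝ, Fin n → ℝ) M :=
  tangentMap 𝓘(ℝ, Fin n → ℝ) 𝓘(ℝ, Fin n → ℝ) (extChartAt 𝓘(ℝ, Fin n → ℝ) p).symm ⟨x, y⟩

/-- The part of `D ⊆ TM` over the domain of the preferred chart at `p`, in coordinates. -/
def coordDomain (D : Set (TangentBundle 𝓘(ℝ, Fin n → ℝ) M)) (p : M) :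
    Set ((Fin n → ℝ) × (Fin n → ℝ)) :=
  {z | z.1 ∈ (extChartAt 𝓘(ℝ, Fin n → ℝ) p).target ∧ coordVec p z.1 z.2 ∈ D}

/-- A function on `TM` in coordinates. -/
def coordFun (L : TangentBundle 𝓘(ℝ, Fin n → ℝ) M → ℝ) (p : M) (x y : Fin n → ℝ) : ℝ :=
  L (coordVec p x y)

/-- A covector field depending on the supporting element: it assigns to each tangent vector `w`
at a point of `M` a covector `b_w` at that point. -/
abbrev CovectorField (n : ℕ) (M : Type*) [TopologicalSpace M]
    [ChartedSpace (Fin n → ℝ) M] : Type _ :=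
  (w : TangentBundle 𝓘(ℝ, Fin n → ℝ) M) → (TangentSpace 𝓘(ℝ, Fin n → ℝ) w.1 →L[ℝ] ℝ)

/-- The components `b_i(x, y)` of a covector field: the value of `b` on `∂/∂xⁱ`. -/
def coordCovec (b : CovectorField n M) (p : M) (x y : Fin n → ℝ) : Fin n → ℝ := fun i =>
  b (coordVec p x y) (coordVec p x (Pi.single i 1)).2

/-- `L` is a Finsler metric function on the open cone `D` of nonzero tangent vectors: it is smooth,
positive, positively homogeneous of degree one, and has a positive definite metric tensor. -/
structure IsFinslerMetric [IsManifold 𝓘(ℝ, Fin n → ℝ) ∞ M]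
    (D : Set (TangentBundle 𝓘(ℝ, Fin n → ℝ) M))
    (L : TangentBundle 𝓘(ℝ, Fin n → ℝ) M → ℝ) : Prop where
  isOpen : IsOpen D
  ne_zero : ∀ w ∈ D, w.2 ≠ 0
  cone : ∀ w ∈ D, ∀ c : ℝ, 0 < c → (⟨w.1, c • w.2⟩ : TangentBundle 𝓘(ℝ, Fin n → ℝ) M) ∈ D
  smooth : ContMDiffOn 𝓘(ℝ, Fin n → ℝ).tangent 𝓘(ℝ, ℝ) ∞ L D
  pos : ∀ w ∈ D, 0 < L w
  homog : ∀ w ∈ D, ∀ c : ℝ, 0 < c → L ⟨w.1, c • w.2⟩ = c * L w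
  posDef : ∀ p : M, ∀ z ∈ coordDomain D p, (metric (coordFun L p) z.1 z.2).PosDef

/-- The covector field `b` is smooth on `D`: it has smooth components in every chart. -/
def IsSmoothCovectorField (D : Set (TangentBundle 𝓘(ℝ, Fin n → ℝ) M))
    (b : CovectorField n M) : Prop :=
  ∀ p : M, ContDiffOn ℝ ∞ (fun z : (Fin n → ℝ) × (Fin n → ℝ) => coordCovec b p z.1 z.2)
    (coordDomain D p)

/-- `b` is an h-vector: `b_i|_k = 0` and `L C^h_ij b_h = ρ h_ij` for a scalar `ρ ≠ 0`. -/
def IsHVector (D : Set (TangentBundle 𝓘(ℝ, Fin n → ℝ) M)) (L : TangentBundle 𝓘(ℝ, Fin n → ℝ) M → ℝ)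
    (b : CovectorField n M) : Prop :=
  ∃ ρ : TangentBundle 𝓘(ℝ, Fin n → ℝ) M → ℝ, (∀ w ∈ D, ρ w ≠ 0) ∧
    ∀ p : M, ∀ z ∈ coordDomain D p,
      (∀ i k, vCov (coordFun L p) (coordCovec b p) i k z.1 z.2 = 0) ∧
      ∀ i j, coordFun L p z.1 z.2 *
          ∑ h, cartanTensorUp (coordFun L p) h i j z.1 z.2 * coordCovec b p z.1 z.2 h
        = ρ (coordVec p z.1 z.2) * angular (coordFun L p) i j z.1 z.2

/-- `b` is a gradient: `b_{i|j} = b_{j|i}` for the Cartan connection of `L`. -/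
def IsGradient (D : Set (TangentBundle 𝓘(ℝ, Fin n → ℝ) M)) (L : TangentBundle 𝓘(ℝ, Fin n → ℝ) M → ℝ)
    (b : CovectorField n M) : Prop :=
  ∀ p : M, ∀ z ∈ coordDomain D p, ∀ i j,
    hCov (coordFun L p) (coordCovec b p) i j z.1 z.2
      = hCov (coordFun L p) (coordCovec b p) j i z.1 z.2

/-- The Kropina change `L² / β` of `L`, where `β = b_i(x, y) yⁱ`. -/
def kropina (L : TangentBundle 𝓘(ℝ, Fin n → ℝ) M → ℝ) (b : CovectorField n M)
    (w : TangentBundle 𝓘(ℝ, Fin n → ℝ) M) : ℝ :=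
  L w ^ 2 / b w w.2

/-- A hypersurface: a smooth immersion. (Codimension one is imposed through the dimensions.) -/
def IsImmersedHypersurface (m n : ℕ) {M : Type*} [TopologicalSpace M] [ChartedSpace (Fin n → ℝ) M]
    {S : Type*} [TopologicalSpace S] [ChartedSpace (Fin m → ℝ) S] (φ : S → M) : Prop :=
  ContMDiff 𝓘(ℝ, Fin m → ℝ) 𝓘(ℝ, Fin n → ℝ) ∞ φ ∧
    ∀ s : S, Function.Injective (mfderiv 𝓘(ℝ, Fin m → ℝ) 𝓘(ℝ, Fin n → ℝ) φ s)

/-- The parametric equations `xⁱ = xⁱ(u^α)` of the hypersurface in the charts at `s` and `φ s`. -/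
def patch (φ : S → M) (s : S) : (Fin m → ℝ) → (Fin n → ℝ) :=
  writtenInExtChartAt 𝓘(ℝ, Fin m → ℝ) 𝓘(ℝ, Fin n → ℝ) s φ

/-- The open set of parameters `u` for which `patch φ s` describes the hypersurface. -/
def patchDomain (n : ℕ) {M : Type*} [TopologicalSpace M] [ChartedSpace (Fin n → ℝ) M]
    (φ : S → M) (s : S) : Set (Fin m → ℝ) :=
  {u | u ∈ (extChartAt 𝓘(ℝ, Fin m → ℝ) s).target ∧
    φ ((extChartAt 𝓘(ℝ, Fin m → ℝ) s).symm u) ∈ (extChartAt 𝓘(ℝ, Fin n → ℝ) (φ s)).source}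

/-- The line elements `(u, v)` of the hypersurface whose supporting element lies in `D`. -/
def lineElements (D : Set (TangentBundle 𝓘(ℝ, Fin n → ℝ) M)) (φ : S → M) (s : S) :
    Set ((Fin m → ℝ) × (Fin m → ℝ)) :=
  {z | z.1 ∈ patchDomain n φ s ∧
    (patch φ s z.1, support (patch φ s) z.1 z.2) ∈ coordDomain D (φ s)}

/-- `b` is tangent to the hypersurface: `b_i Nⁱ = 0` for the normals `N` at all its line
elements. -/
def IsTangentTo (m : ℕ) {S : Type*} [TopologicalSpace S] [ChartedSpace (Fin m → ℝ) S]
    (D : Set (TangentBundle 𝓘(ℝ, Fin n → ℝ) M)) (L : TangentBundle 𝓘(ℝ, Fin n → ℝ) M → ℝ)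
    (b : CovectorField n M) (φ : S → M) : Prop :=
  ∀ s : S, ∀ z : (Fin m → ℝ) × (Fin m → ℝ), z ∈ lineElements D φ s → ∀ N : Fin n → ℝ,
    IsUnitNormal (coordFun L (φ s)) (patch φ s) z.1 z.2 N →
    ∑ i, coordCovec b (φ s) (patch φ s z.1) (support (patch φ s) z.1 z.2) i * N i = 0

/-- The hypersurface is a hyperplane of the first kind: each of its paths with respect to the
induced Cartan connection is also a path of the ambient Finsler space. (Being a path is a local
property, so paths within the coordinate patches suffice.) -/
def IsHyperplaneFirstKind (m : ℕ) {S : Type*} [TopologicalSpace S] [ChartedSpace (Fin m → ℝ) S]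
    (D : Set (TangentBundle 𝓘(ℝ, Fin n → ℝ) M))
    (L : TangentBundle 𝓘(ℝ, Fin n → ℝ) M → ℝ) (φ : S → M) : Prop :=
  ∀ s : S, ∀ (a b : ℝ) (c : ℝ → (Fin m → ℝ)),
    IsPath (lineElements D φ s) (inducedConn (coordFun L (φ s)) (patch φ s)) a b c →
    IsPath (coordDomain D (φ s)) (nonlinConn (coordFun L (φ s))) a b (patch φ s ∘ c)

/-- `H_0 = 0` at all line elements of the hypersurface (for either choice of the unit normal). -/
def NormalCurvatureVanishes (m : ℕ) {S : Type*} [TopologicalSpace S] [ChartedSpace (Fin m → ℝ) S]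
    (D : Set (TangentBundle 𝓘(ℝ, Fin n → ℝ) M))
    (L : TangentBundle 𝓘(ℝ, Fin n → ℝ) M → ℝ) (φ : S → M) : Prop :=
  ∀ s : S, ∀ z : (Fin m → ℝ) × (Fin m → ℝ), z ∈ lineElements D φ s → ∀ N : Fin n → ℝ,
    IsUnitNormal (coordFun L (φ s)) (patch φ s) z.1 z.2 N →
    normalCurvature₀ (coordFun L (φ s)) (patch φ s) N z.1 z.2 = 0

end Manifolds

end FinslerHypersurface

end

/-!
The conditions on both hypersurfaces reduce to the vanishing of `H_0`, and `H_0` is compared for `L`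
and its Kropina change `*L = L²/β`, `β = b_i yⁱ`, at each line element in coordinates.

*Hyperplanes of the first kind.* Put `wⁱ = (B^i_0α + G^i_j B^j_α) v^α` (`gaussVec`), so that
`H_0 = g(N, w)`. The induced connection subtracts from `w` exactly its tangential component: along
a path `c` of the induced connection, the image curve `x(c)` satisfies
`x''ⁱ + G^i_j x'ʲ = (w^⊥)ⁱ` (`IsCoordImmersion.hasDerivAt_deriv_comp_path`). Hence `H_0 = 0` makes
all paths ambient ones, and conversely a path of the induced connection through a given line
element, which exists by Picard–Lindelöf, forces `w^⊥ = 0` there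
(`IsCoordImmersion.forall_isPath_iff`).

*Normals of the two metrics.* An h-vector satisfies `∂b_i/∂yʲ = (ρ/L) h_ij`, so that `∂β/∂yⁱ = b_i`
and the Hessian of `β` is proportional to `h_ij`. Therefore the metric tensor of `*L` is a
combination of `g_ij`, of terms with a factor `∂L²/∂yⁱ` and of terms with a factor `b_i`. A
`g`-normal `N` of the hypersurface is orthogonal to `y`, which is tangent, and to `b` by
hypothesis; so `*g N = κ g N` with `κ` independent of `N` (`exists_metric_kropina_mulVec`), and both metrics have the same normals
(`normal_of_normal`).

*Difference of the sprays.* The spray of a Finsler metric is characterized by the Euler–Lagrange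
equation of the squared metric function. The Euler–Lagrange expression of `*L² = L⁴/β²` along the
spray of `L` equals `4 *g_is (*Gˢ - Gˢ)` on the one hand
(`IsCoordFinsler.eulerLagrange_sqL_eq`). On the other hand `L²` and, because `b` is a gradient,
also `β` satisfy the Euler–Lagrange equation along the spray of `L`
(`IsCoordHVector.eulerLagrange_pairing`), so only multiples of `∂L²/∂yⁱ` and `b_i` remain
(`exists_eulerLagrange_sqL_kropina`). These vanish on normals, hence
`*g(N, *w) = *g(N, w) = κ g(N, w)` with `κ ≠ 0`, and the two `H_0` vanish together
(`IsCoordImmersion.normalCurvature₀_kropina`).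
-/

namespace FinslerHypersurface

/-! ### Partial derivatives of scalars on an open set of line elements -/

section Calculus

variable {n : ℕ} {Ω : Set ((Fin n → ℝ) × (Fin n → ℝ))} {f g : Scalar n} {x y : Fin n → ℝ}

/-- Joint smoothness of `f(x, y)` on a set of line elements. -/
def SmoothScalarOn (Ω : Set ((Fin n → ℝ) × (Fin n → ℝ))) (f : Scalar n) : Prop :=
  ContDiffOn ℝ ∞ (fun z : (Fin n → ℝ) × (Fin n → ℝ) => f z.1 z.2) Ω

/-- The derivative of `f(x, y)` in the direction `ξ` of the `(x, y)`-space. Both kinds of partial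
derivatives and the derivative along a spray are instances of it. -/
noncomputable def dirDeriv (ξ : (Fin n → ℝ) × (Fin n → ℝ)) (f : Scalar n) : Scalar n := fun x y =>
  fderiv ℝ (fun z : (Fin n → ℝ) × (Fin n → ℝ) => f z.1 z.2) (x, y) ξ

/-- Positive homogeneity of degree `k` in the supporting element. -/
def HomogOn (Ω : Set ((Fin n → ℝ) × (Fin n → ℝ))) (k : ℕ) (f : Scalar n) : Prop :=
  ∀ x y, (x, y) ∈ Ω → ∀ c : ℝ, 0 < c → f x (c • y) = c ^ k * f x y

theorem SmoothScalarOn.differentiableAt (hΩ : IsOpen Ω) (hf : SmoothScalarOn Ω f)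
    (h : (x, y) ∈ Ω) :
    DifferentiableAt ℝ (fun z : (Fin n → ℝ) × (Fin n → ℝ) => f z.1 z.2) (x, y) :=
  (ContDiffOn.contDiffAt hf (hΩ.mem_nhds h)).differentiableAt (by simp)

theorem SmoothScalarOn.differentiableAt_snd (hΩ : IsOpen Ω) (hf : SmoothScalarOn Ω f)
    (h : (x, y) ∈ Ω) : DifferentiableAt ℝ (fun y' => f x y') y :=
  (hf.differentiableAt hΩ h).comp y (f := fun y' => (x, y')) (by fun_prop)

theorem dX_eq_dirDeriv (hΩ : IsOpen Ω) (hf : SmoothScalarOn Ω f) (h : (x, y) ∈ Ω) (i : Fin n) :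
    dX i f x y = dirDeriv (Pi.single i 1, 0) f x y := by
  have h1 := (hf.differentiableAt hΩ h).hasFDerivAt.comp x (f := fun x' => (x', y))
    (hasFDerivAt_prodMk_left x y)
  change fderiv ℝ ((fun z : (Fin n → ℝ) × (Fin n → ℝ) => f z.1 z.2) ∘ fun x' => (x', y)) x _ = _
  rw [h1.fderiv]
  simp [dirDeriv]

theorem dY_eq_dirDeriv (hΩ : IsOpen Ω) (hf : SmoothScalarOn Ω f) (h : (x, y) ∈ Ω) (i : Fin n) :
    dY i f x y = dirDeriv (0, Pi.single i 1) f x y := by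
  have h1 := (hf.differentiableAt hΩ h).hasFDerivAt.comp y (f := fun y' => (x, y'))
    (hasFDerivAt_prodMk_right x y)
  change fderiv ℝ ((fun z : (Fin n → ℝ) × (Fin n → ℝ) => f z.1 z.2) ∘ fun y' => (x, y')) y _ = _
  rw [h1.fderiv]
  simp [dirDeriv]

theorem dirDeriv_congr (hΩ : IsOpen Ω) (hfg : ∀ x y, (x, y) ∈ Ω → f x y = g x y)
    (h : (x, y) ∈ Ω) (ξ) : dirDeriv ξ f x y = dirDeriv ξ g x y := by
  have : (fun z : (Fin n → ℝ) × (Fin n → ℝ) => f z.1 z.2) =ᶠ[nhds (x, y)] fun z => g z.1 z.2 := by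
    filter_upwards [hΩ.mem_nhds h] with z hz using hfg z.1 z.2 hz
  simp only [dirDeriv, this.fderiv_eq]

theorem dX_congr (hΩ : IsOpen Ω) (hfg : ∀ x y, (x, y) ∈ Ω → f x y = g x y)
    (h : (x, y) ∈ Ω) (i : Fin n) : dX i f x y = dX i g x y := by
  have : (fun x' => f x' y) =ᶠ[nhds x] fun x' => g x' y := by
    have hc : Continuous fun x' : Fin n → ℝ => (x', y) := by fun_prop
    filter_upwards [(hΩ.preimage hc).mem_nhds h] with z hz using hfg z y hz
  simp only [dX, this.fderiv_eq]

theorem dY_congr (hΩ : IsOpen Ω) (hfg : ∀ x y, (x, y) ∈ Ω → f x y = g x y)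
    (h : (x, y) ∈ Ω) (i : Fin n) : dY i f x y = dY i g x y := by
  have : (fun y' => f x y') =ᶠ[nhds y] fun y' => g x y' := by
    have hc : Continuous fun y' : Fin n → ℝ => (x, y') := by fun_prop
    filter_upwards [(hΩ.preimage hc).mem_nhds h] with z hz using hfg x z hz
  simp only [dY, this.fderiv_eq]

theorem SmoothScalarOn.congr (hf : SmoothScalarOn Ω f)
    (hfg : ∀ x y, (x, y) ∈ Ω → g x y = f x y) : SmoothScalarOn Ω g :=
  ContDiffOn.congr hf fun z hz => hfg z.1 z.2 hz

theorem SmoothScalarOn.dirDeriv (hΩ : IsOpen Ω) (hf : SmoothScalarOn Ω f) (ξ) :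
    SmoothScalarOn Ω (dirDeriv ξ f) :=
  (ContDiffOn.fderiv_of_isOpen (m := ∞) hf hΩ (by simp)).clm_apply contDiffOn_const

theorem SmoothScalarOn.dX (hΩ : IsOpen Ω) (hf : SmoothScalarOn Ω f) (i : Fin n) :
    SmoothScalarOn Ω (dX i f) :=
  (hf.dirDeriv hΩ _).congr fun _ _ h => dX_eq_dirDeriv hΩ hf h i

theorem SmoothScalarOn.dY (hΩ : IsOpen Ω) (hf : SmoothScalarOn Ω f) (i : Fin n) :
    SmoothScalarOn Ω (dY i f) :=
  (hf.dirDeriv hΩ _).congr fun _ _ h => dY_eq_dirDeriv hΩ hf h i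

theorem dirDeriv_eq_sum (hΩ : IsOpen Ω) (hf : SmoothScalarOn Ω f) (h : (x, y) ∈ Ω)
    (a b : Fin n → ℝ) :
    dirDeriv (a, b) f x y = ∑ s, a s * dX s f x y + ∑ s, b s * dY s f x y := by
  have h1 : ((a, b) : (Fin n → ℝ) × (Fin n → ℝ)) =
      ∑ s, a s • ((Pi.single s 1 : Fin n → ℝ), (0 : Fin n → ℝ))
        + ∑ s, b s • ((0 : Fin n → ℝ), (Pi.single s 1 : Fin n → ℝ)) := by
    ext j <;> simp [Prod.fst_sum, Prod.snd_sum, Finset.sum_apply, Pi.single_apply]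
  simp only [dX_eq_dirDeriv hΩ hf h, dY_eq_dirDeriv hΩ hf h, dirDeriv]
  rw [h1, map_add, map_sum, map_sum]
  simp only [map_smul, smul_eq_mul]

theorem dirDeriv_comm (hΩ : IsOpen Ω) (hf : SmoothScalarOn Ω f) (h : (x, y) ∈ Ω) (ξ η) :
    dirDeriv ξ (dirDeriv η f) x y = dirDeriv η (dirDeriv ξ f) x y := by
  have hc : ContDiffAt ℝ ∞ (fun z : (Fin n → ℝ) × (Fin n → ℝ) => f z.1 z.2) (x, y) :=
    ContDiffOn.contDiffAt hf (hΩ.mem_nhds h)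
  have hs := hc.isSymmSndFDerivAt (by simp; exact WithTop.coe_le_coe.2 le_top)
  have hd : DifferentiableAt ℝ
      (fderiv ℝ (fun z : (Fin n → ℝ) × (Fin n → ℝ) => f z.1 z.2)) (x, y) :=
    (hc.fderiv_right (m := 1) (by norm_cast)).differentiableAt (by simp)
  have key : ∀ a b : (Fin n → ℝ) × (Fin n → ℝ), dirDeriv a (dirDeriv b f) x y =
      fderiv ℝ (fderiv ℝ (fun z : (Fin n → ℝ) × (Fin n → ℝ) => f z.1 z.2)) (x, y) a b := by
    intro a b
    have := (hd.hasFDerivAt.clm_apply (hasFDerivAt_const b (x, y))).fderiv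
    simp only [dirDeriv]
    rw [show (fun z : (Fin n → ℝ) × (Fin n → ℝ) =>
      (fderiv ℝ (fun z : (Fin n → ℝ) × (Fin n → ℝ) => f z.1 z.2) (z.1, z.2)) b) =
      fun z => (fderiv ℝ (fun z : (Fin n → ℝ) × (Fin n → ℝ) => f z.1 z.2) z) b from rfl, this]
    simp
  rw [key, key, hs.eq]

theorem dY_dirDeriv_comm (hΩ : IsOpen Ω) (hf : SmoothScalarOn Ω f) (h : (x, y) ∈ Ω) (i : Fin n)
    (ξ) : dY i (dirDeriv ξ f) x y = dirDeriv ξ (dY i f) x y := by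
  rw [dY_eq_dirDeriv hΩ (hf.dirDeriv hΩ ξ) h, dirDeriv_comm hΩ hf h]
  exact dirDeriv_congr hΩ (fun _ _ h' => (dY_eq_dirDeriv hΩ hf h' i).symm) h ξ

theorem dY_comm (hΩ : IsOpen Ω) (hf : SmoothScalarOn Ω f) (h : (x, y) ∈ Ω) (i j : Fin n) :
    dY i (dY j f) x y = dY j (dY i f) x y := by
  rw [dY_eq_dirDeriv hΩ (hf.dY hΩ i) h, ← dY_dirDeriv_comm hΩ hf h]
  exact dY_congr hΩ (fun _ _ h' => dY_eq_dirDeriv hΩ hf h' j) h i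

theorem dY_dX_comm (hΩ : IsOpen Ω) (hf : SmoothScalarOn Ω f) (h : (x, y) ∈ Ω) (i j : Fin n) :
    dY i (dX j f) x y = dX j (dY i f) x y := by
  rw [dX_eq_dirDeriv hΩ (hf.dY hΩ i) h, ← dY_dirDeriv_comm hΩ hf h]
  exact dY_congr hΩ (fun _ _ h' => dX_eq_dirDeriv hΩ hf h' j) h i

theorem SmoothScalarOn.mul (hf : SmoothScalarOn Ω f) (hg : SmoothScalarOn Ω g) :
    SmoothScalarOn Ω (fun x y => f x y * g x y) :=
  ContDiffOn.mul hf hg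

theorem SmoothScalarOn.add (hf : SmoothScalarOn Ω f) (hg : SmoothScalarOn Ω g) :
    SmoothScalarOn Ω (fun x y => f x y + g x y) :=
  ContDiffOn.add hf hg

theorem SmoothScalarOn.sub (hf : SmoothScalarOn Ω f) (hg : SmoothScalarOn Ω g) :
    SmoothScalarOn Ω (fun x y => f x y - g x y) :=
  ContDiffOn.sub hf hg

theorem smoothScalarOn_const (c : ℝ) : SmoothScalarOn Ω (fun _ _ => c) :=
  contDiffOn_const

theorem smoothScalarOn_coord (s : Fin n) : SmoothScalarOn Ω (fun _ y => y s) := by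
  unfold SmoothScalarOn; fun_prop

theorem SmoothScalarOn.sum {ι : Type*} {s : Finset ι} {f : ι → Scalar n}
    (hf : ∀ i ∈ s, SmoothScalarOn Ω (f i)) : SmoothScalarOn Ω (fun x y => ∑ i ∈ s, f i x y) :=
  ContDiffOn.sum hf

theorem dirDeriv_mul (hΩ : IsOpen Ω) (hf : SmoothScalarOn Ω f) (hg : SmoothScalarOn Ω g)
    (h : (x, y) ∈ Ω) (ξ) :
    dirDeriv ξ (fun x y => f x y * g x y) x y
      = f x y * dirDeriv ξ g x y + g x y * dirDeriv ξ f x y := by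
  have := ((hf.differentiableAt hΩ h).hasFDerivAt.mul
    (hg.differentiableAt hΩ h).hasFDerivAt).fderiv
  simp only [dirDeriv]
  erw [this]
  simp

theorem dirDeriv_add (hΩ : IsOpen Ω) (hf : SmoothScalarOn Ω f) (hg : SmoothScalarOn Ω g)
    (h : (x, y) ∈ Ω) (ξ) :
    dirDeriv ξ (fun x y => f x y + g x y) x y = dirDeriv ξ f x y + dirDeriv ξ g x y := by
  have := ((hf.differentiableAt hΩ h).hasFDerivAt.add
    (hg.differentiableAt hΩ h).hasFDerivAt).fderiv
  simp only [dirDeriv]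
  erw [this]
  simp

theorem dY_mul (hΩ : IsOpen Ω) (hf : SmoothScalarOn Ω f) (hg : SmoothScalarOn Ω g)
    (h : (x, y) ∈ Ω) (i : Fin n) :
    dY i (fun x y => f x y * g x y) x y = f x y * dY i g x y + g x y * dY i f x y := by
  rw [dY_eq_dirDeriv hΩ (hf.mul hg) h, dirDeriv_mul hΩ hf hg h, dY_eq_dirDeriv hΩ hf h,
    dY_eq_dirDeriv hΩ hg h]

theorem dY_sum (hΩ : IsOpen Ω) {ι : Type*} {s : Finset ι} {f : ι → Scalar n}
    (hf : ∀ i ∈ s, SmoothScalarOn Ω (f i)) (h : (x, y) ∈ Ω) (k : Fin n) :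
    dY k (fun x y => ∑ i ∈ s, f i x y) x y = ∑ i ∈ s, dY k (f i) x y := by
  unfold dY
  rw [fderiv_fun_sum fun i hi => (hf i hi).differentiableAt_snd hΩ h]
  simp

theorem dX_sum_mul_coord (hΩ : IsOpen Ω) {f : Fin n → Scalar n}
    (hf : ∀ i, SmoothScalarOn Ω (f i)) (h : (x, y) ∈ Ω) (k : Fin n) :
    dX k (fun x y => ∑ i, f i x y * y i) x y = ∑ i, dX k (f i) x y * y i := by
  have hd : ∀ i, DifferentiableAt ℝ (fun x' => f i x' y) x := fun i =>
    ((hf i).differentiableAt hΩ h).comp x (f := fun x' => (x', y)) (by fun_prop)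
  unfold dX
  rw [fderiv_fun_sum fun i _ => (hd i).mul_const (y i)]
  simp only [_root_.sum_apply]
  refine Finset.sum_congr rfl fun i _ => ?_
  rw [fderiv_mul_const (hd i)]
  simp [mul_comm]

theorem dY_coord (s i : Fin n) : dY i (fun _ y => y s) x y = if s = i then 1 else 0 := by
  have : HasFDerivAt (fun y : Fin n → ℝ => y s)
    (ContinuousLinearMap.proj (R := ℝ) (φ := fun _ : Fin n => ℝ) s) y := hasFDerivAt_apply s y
  simp [dY, this.fderiv, Pi.single_apply]

theorem HomogOn.dY (hΩ : IsOpen Ω) {k : ℕ} (hf : HomogOn Ω (k + 1) f) (i : Fin n) :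
    HomogOn Ω k (dY i f) := by
  intro x y h c hc
  have h1 : fderiv ℝ (fun y' => f x (c • y')) y = fderiv ℝ (fun y' => c ^ (k + 1) • f x y') y := by
    apply Filter.EventuallyEq.fderiv_eq
    have hcont : Continuous fun y' : Fin n → ℝ => (x, y') := by fun_prop
    filter_upwards [(hΩ.preimage hcont).mem_nhds h] with z hz using hf x z hz c hc
  have h2 : fderiv ℝ (fun y' => f x (c • y')) y = c • fderiv ℝ (fun y' => f x y') (c • y) :=
    fderiv_comp_smul (f := fun y' => f x y') c
  have h3 : fderiv ℝ (fun y' => c ^ (k + 1) • f x y') y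
      = c ^ (k + 1) • fderiv ℝ (fun y' => f x y') y := by
    exact congrFun (fderiv_const_smul_field (𝕜 := ℝ) (f := fun y' => f x y') (c ^ (k + 1))) y
  rw [h2, h3] at h1
  have h4 := congrArg (fun φ => φ (Pi.single i (1 : ℝ))) h1
  simp only [_root_.smul_apply, smul_eq_mul] at h4
  change fderiv ℝ (fun y' => f x y') (c • y) _ = c ^ k * fderiv ℝ (fun y' => f x y') y _
  apply mul_left_cancel₀ hc.ne'
  rw [h4]; ring

theorem HomogOn.dX (hΩ : IsOpen Ω) {k : ℕ} (hf : HomogOn Ω k f) (i : Fin n) :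
    HomogOn Ω k (dX i f) := by
  intro x y h c hc
  have h1 : fderiv ℝ (fun x' => f x' (c • y)) x = fderiv ℝ (fun x' => c ^ k • f x' y) x := by
    apply Filter.EventuallyEq.fderiv_eq
    have hcont : Continuous fun x' : Fin n → ℝ => (x', y) := by fun_prop
    filter_upwards [(hΩ.preimage hcont).mem_nhds h] with z hz using hf z y hz c hc
  have h3 : fderiv ℝ (fun x' => c ^ k • f x' y) x = c ^ k • fderiv ℝ (fun x' => f x' y) x := by
    exact congrFun (fderiv_const_smul_field (𝕜 := ℝ) (f := fun x' => f x' y) (c ^ k)) x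
  change fderiv ℝ (fun x' => f x' (c • y)) x _ = c ^ k * fderiv ℝ (fun x' => f x' y) x _
  rw [h1, h3]; simp

/-- Euler's theorem on homogeneous functions. -/
theorem HomogOn.euler (hΩ : IsOpen Ω) {k : ℕ} (hf : HomogOn Ω k f) (hs : SmoothScalarOn Ω f)
    (h : (x, y) ∈ Ω) : ∑ i, y i * FinslerHypersurface.dY i f x y = k * f x y := by
  have h1 : HasDerivAt (fun c : ℝ => f x (c • y)) (fderiv ℝ (fun y' => f x y') y y) 1 := by
    have ha : HasFDerivAt (fun y' => f x y') (fderiv ℝ (fun y' => f x y') y) ((1 : ℝ) • y) := by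
      rw [one_smul]; exact (hs.differentiableAt_snd hΩ h).hasFDerivAt
    have hb : HasDerivAt (fun c : ℝ => c • y) y 1 := by
      simpa using (hasDerivAt_id (1 : ℝ)).smul_const y
    exact ha.comp_hasDerivAt 1 hb
  have h2 : HasDerivAt (fun c : ℝ => f x (c • y)) (k * f x y) 1 := by
    have : HasDerivAt (fun c : ℝ => c ^ k * f x y) (k * f x y) 1 := by
      simpa using (hasDerivAt_pow k (1 : ℝ)).mul_const (f x y)
    refine this.congr_of_eventuallyEq ?_
    filter_upwards [lt_mem_nhds (zero_lt_one (α := ℝ))] with c hc using hf x y h c hc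
  rw [h2.unique h1]
  have h3 : ∀ φ : (Fin n → ℝ) →L[ℝ] ℝ, φ y = ∑ i, y i * φ (Pi.single i 1) := fun φ => by
    conv_lhs => rw [pi_eq_sum_univ' y, map_sum]
    simp only [map_smul, smul_eq_mul]
  exact (h3 _).symm

end Calculus

/-! ### The spray of a Finsler metric and its Euler–Lagrange characterization -/

section Spray

variable {n : ℕ} {Ω : Set ((Fin n → ℝ) × (Fin n → ℝ))} {L K f : Scalar n} {x y : Fin n → ℝ}

/-- A Finsler metric function in coordinates, on an open set `Ω` of line elements.
Homogeneity is required at points of `Ω` only, for all positive multiples. -/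
structure IsCoordFinsler (Ω : Set ((Fin n → ℝ) × (Fin n → ℝ))) (L : Scalar n) : Prop where
  isOpen : IsOpen Ω
  smooth : SmoothScalarOn Ω L
  pos : ∀ x y, (x, y) ∈ Ω → 0 < L x y
  homog : HomogOn Ω 1 L
  posDef : ∀ x y, (x, y) ∈ Ω → (metric L x y).PosDef

theorem IsCoordFinsler.smooth_sqL (hL : IsCoordFinsler Ω L) : SmoothScalarOn Ω (sqL L) :=
  ContDiffOn.pow hL.smooth 2

theorem IsCoordFinsler.homog_sqL (hL : IsCoordFinsler Ω L) : HomogOn Ω 2 (sqL L) := by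
  intro x y h c hc
  simp only [sqL, hL.homog x y h c hc]
  ring

theorem IsCoordFinsler.smooth_metric (hL : IsCoordFinsler Ω L) (i j : Fin n) :
    SmoothScalarOn Ω (fun x y => metric L x y i j) :=
  (smoothScalarOn_const _).mul ((hL.smooth_sqL.dY hL.isOpen j).dY hL.isOpen i)

theorem IsCoordFinsler.metric_symm (hL : IsCoordFinsler Ω L) (h : (x, y) ∈ Ω) (i j : Fin n) :
    metric L x y i j = metric L x y j i := by
  simp only [metric, Matrix.of_apply, dY_comm hL.isOpen hL.smooth_sqL h i j]

theorem IsCoordFinsler.isSymm_metric (hL : IsCoordFinsler Ω L) (h : (x, y) ∈ Ω) :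
    (metric L x y)ᵀ = metric L x y := by
  ext i j; exact hL.metric_symm h j i

theorem IsCoordFinsler.metric_smul (hL : IsCoordFinsler Ω L) (h : (x, y) ∈ Ω) {c : ℝ}
    (hc : 0 < c) : metric L x (c • y) = metric L x y := by
  ext i j
  have h1 : HomogOn Ω 1 (dY j (sqL L)) := HomogOn.dY hL.isOpen hL.homog_sqL j
  have h0 : HomogOn Ω 0 (dY i (dY j (sqL L))) := HomogOn.dY hL.isOpen h1 i
  simp only [metric, Matrix.of_apply, h0 x y h c hc, pow_zero, one_mul]

/-- `g_ij yʲ = ½ ∂L²/∂yⁱ`. -/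
theorem IsCoordFinsler.metric_mulVec (hL : IsCoordFinsler Ω L) (h : (x, y) ∈ Ω) (i : Fin n) :
    (metric L x y *ᵥ y) i = 1 / 2 * dY i (sqL L) x y := by
  have h1 : HomogOn Ω 1 (dY i (sqL L)) := HomogOn.dY hL.isOpen hL.homog_sqL i
  have h2 := h1.euler hL.isOpen (hL.smooth_sqL.dY hL.isOpen i) h
  simp only [Nat.cast_one, one_mul] at h2
  rw [← h2, Finset.mul_sum]
  change ∑ j, metric L x y i j * y j = _
  refine Finset.sum_congr rfl fun j _ => ?_
  rw [hL.metric_symm h i j, metric, Matrix.of_apply]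
  ring

theorem IsCoordFinsler.det_ne_zero (hL : IsCoordFinsler Ω L) (h : (x, y) ∈ Ω) :
    (metric L x y).det ≠ 0 :=
  ((Matrix.isUnit_iff_isUnit_det _).1 (hL.posDef x y h).isUnit).ne_zero

/-- The determinant of a matrix with smooth entries is smooth. -/
theorem smoothScalarOn_det {k : ℕ} {A : (Fin n → ℝ) → (Fin n → ℝ) → Matrix (Fin k) (Fin k) ℝ}
    (hA : ∀ i j, SmoothScalarOn Ω (fun x y => A x y i j)) :
    SmoothScalarOn Ω (fun x y => (A x y).det) := by
  simp only [Matrix.det_apply']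
  exact ContDiffOn.sum fun σ _ => contDiffOn_const.mul (contDiffOn_prod fun i _ => hA _ _)

/-- The inverse of a nonsingular matrix with smooth entries has smooth entries. -/
theorem smoothScalarOn_inv {k : ℕ} {A : (Fin n → ℝ) → (Fin n → ℝ) → Matrix (Fin k) (Fin k) ℝ}
    (hA : ∀ i j, SmoothScalarOn Ω (fun x y => A x y i j))
    (hdet : ∀ x y, (x, y) ∈ Ω → (A x y).det ≠ 0) (i j : Fin k) :
    SmoothScalarOn Ω (fun x y => (A x y)⁻¹ i j) := by
  simp only [Matrix.inv_def, Ring.inverse_eq_inv', Matrix.smul_apply, smul_eq_mul,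
    Matrix.adjugate_apply]
  refine ContDiffOn.mul (ContDiffOn.inv (smoothScalarOn_det hA) fun z hz => hdet _ _ hz) ?_
  refine smoothScalarOn_det (A := fun x y => (A x y).updateRow j (Pi.single i 1)) fun a b => ?_
  by_cases hab : a = j
  · subst hab
    simp only [Matrix.updateRow_self]
    exact contDiffOn_const
  · simp only [Matrix.updateRow_ne hab]
    exact hA a b

theorem IsCoordFinsler.smooth_metricInv (hL : IsCoordFinsler Ω L) (i j : Fin n) :
    SmoothScalarOn Ω (fun x y => metricInv L x y i j) :=
  smoothScalarOn_inv hL.smooth_metric (fun _ _ h => hL.det_ne_zero h) i j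

theorem IsCoordFinsler.smooth_sprayCoeff (hL : IsCoordFinsler Ω L) (i : Fin n) :
    SmoothScalarOn Ω (sprayCoeff L i) := by
  refine (smoothScalarOn_const (1 / 4)).mul (SmoothScalarOn.sum fun r _ =>
    (hL.smooth_metricInv i r).mul (SmoothScalarOn.sub (SmoothScalarOn.sum fun s _ =>
      (smoothScalarOn_coord s).mul ((hL.smooth_sqL.dX hL.isOpen s).dY hL.isOpen r))
        (hL.smooth_sqL.dX hL.isOpen r)))

theorem IsCoordFinsler.smooth_nonlinConn (hL : IsCoordFinsler Ω L) (i j : Fin n) :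
    SmoothScalarOn Ω (nonlinConn L i j) :=
  (hL.smooth_sprayCoeff i).dY hL.isOpen j

theorem IsCoordFinsler.homog_sprayCoeff (hL : IsCoordFinsler Ω L) (i : Fin n) :
    HomogOn Ω 2 (sprayCoeff L i) := by
  intro x y h c hc
  have h1 : ∀ s, HomogOn Ω 2 (dX s (sqL L)) := fun s => HomogOn.dX hL.isOpen hL.homog_sqL s
  have h2 : ∀ r s, HomogOn Ω 1 (dY r (dX s (sqL L))) := fun r s => HomogOn.dY hL.isOpen (h1 s) r
  simp only [sprayCoeff, metricInv, hL.metric_smul h hc, h1 _ x y h c hc, h2 _ _ x y h c hc,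
    Pi.smul_apply, smul_eq_mul, Finset.mul_sum]
  refine Finset.sum_congr rfl fun r _ => ?_
  rw [show ∑ s, c * y s * (c ^ 1 * dY r (dX s (sqL L)) x y)
    = c ^ 2 * ∑ s, y s * dY r (dX s (sqL L)) x y by
      rw [Finset.mul_sum]; exact Finset.sum_congr rfl fun s _ => by ring]
  ring

/-- `G^i_j yʲ = 2 G^i`. -/
theorem IsCoordFinsler.nonlinConn_mul (hL : IsCoordFinsler Ω L) (h : (x, y) ∈ Ω) (i : Fin n) :
    ∑ j, nonlinConn L i j x y * y j = 2 * sprayCoeff L i x y := by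
  have := (hL.homog_sprayCoeff i).euler hL.isOpen (hL.smooth_sprayCoeff i) h
  push_cast at this
  rw [← this]
  exact Finset.sum_congr rfl fun j _ => mul_comm _ _

/-- The value at `(x, y)` of the spray `yˢ ∂/∂xˢ - 2 Gˢ ∂/∂yˢ` of `L`. -/
noncomputable def sprayVec (L : Scalar n) (x y : Fin n → ℝ) : (Fin n → ℝ) × (Fin n → ℝ) :=
  (y, fun s => -2 * sprayCoeff L s x y)

/-- The Euler–Lagrange expression of `f` along the spray of `L`: the rate of change of `∂f/∂yⁱ`
along the spray minus `∂f/∂xⁱ`. -/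
noncomputable def eulerLagrange (L f : Scalar n) (i : Fin n) (x y : Fin n → ℝ) : ℝ :=
  dirDeriv (sprayVec L x y) (dY i f) x y - dX i f x y

theorem eulerLagrange_eq (hΩ : IsOpen Ω) (hf : SmoothScalarOn Ω f) (h : (x, y) ∈ Ω) (i : Fin n) :
    eulerLagrange L f i x y = ∑ s, y s * dX s (dY i f) x y
      - 2 * ∑ s, sprayCoeff L s x y * dY s (dY i f) x y - dX i f x y := by
  rw [eulerLagrange, sprayVec, dirDeriv_eq_sum hΩ (hf.dY hΩ i) h, Finset.mul_sum, sub_eq_add_neg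
    (Finset.sum _ _), ← Finset.sum_neg_distrib]
  simp only [neg_mul, mul_assoc]

/-- The spray coefficients of `L` are the solution of the Euler–Lagrange equation of `L²`. -/
theorem IsCoordFinsler.eulerLagrange_sqL (hL : IsCoordFinsler Ω L) (h : (x, y) ∈ Ω) (i : Fin n) :
    eulerLagrange L (sqL L) i x y = 0 := by
  set R : Fin n → ℝ := fun r =>
    (∑ s, y s * dY r (dX s (sqL L)) x y) - dX r (sqL L) x y with hR
  have h1 : (fun s => sprayCoeff L s x y) = (1 / 4 : ℝ) • (metricInv L x y *ᵥ R) := rfl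
  have h2 : metric L x y *ᵥ (fun s => sprayCoeff L s x y) = (1 / 4 : ℝ) • R := by
    rw [h1, Matrix.mulVec_smul, Matrix.mulVec_mulVec, metricInv,
      Matrix.mul_nonsing_inv _ (Ne.isUnit (hL.det_ne_zero h)), Matrix.one_mulVec]
  have h3 : ∑ s, metric L x y i s * sprayCoeff L s x y = 1 / 4 * R i := congrFun h2 i
  rw [eulerLagrange_eq hL.isOpen hL.smooth_sqL h]
  have h4 : ∑ s, sprayCoeff L s x y * dY s (dY i (sqL L)) x y
      = 2 * ∑ s, metric L x y i s * sprayCoeff L s x y := by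
    rw [Finset.mul_sum]
    refine Finset.sum_congr rfl fun s _ => ?_
    rw [hL.metric_symm h, metric, Matrix.of_apply]; ring
  rw [h4, h3, hR]
  simp only [dY_dX_comm hL.isOpen hL.smooth_sqL h]
  ring

/-- The Euler–Lagrange expression of `K²` along the spray of another metric `L` measures the
difference of the two sprays. -/
theorem IsCoordFinsler.eulerLagrange_sqL_eq (hK : IsCoordFinsler Ω K) (L : Scalar n)
    (h : (x, y) ∈ Ω) (i : Fin n) :
    eulerLagrange L (sqL K) i x y
      = 4 * (metric K x y *ᵥ fun s => sprayCoeff K s x y - sprayCoeff L s x y) i := by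
  have h1 := hK.eulerLagrange_sqL h i
  rw [eulerLagrange_eq hK.isOpen hK.smooth_sqL h] at h1 ⊢
  have h2 : (metric K x y *ᵥ fun s => sprayCoeff K s x y - sprayCoeff L s x y) i
      = 1 / 2 * (∑ s, sprayCoeff K s x y * dY s (dY i (sqL K)) x y
        - ∑ s, sprayCoeff L s x y * dY s (dY i (sqL K)) x y) := by
    rw [← Finset.sum_sub_distrib, Finset.mul_sum]
    change ∑ s, metric K x y i s * (sprayCoeff K s x y - sprayCoeff L s x y) = _
    refine Finset.sum_congr rfl fun s _ => ?_
    rw [hK.metric_symm h, metric, Matrix.of_apply]; ring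
  rw [h2]; linarith

end Spray

/-! ### The Kropina change by an h-vector -/

section Kropina

variable {n : ℕ} {Ω : Set ((Fin n → ℝ) × (Fin n → ℝ))} {L K : Scalar n}
  {b : (Fin n → ℝ) → (Fin n → ℝ) → Fin n → ℝ} {ρ : Scalar n} {x y : Fin n → ℝ}

/-- The scalar `β = b_i yⁱ`. -/
noncomputable def pairing (b : (Fin n → ℝ) → (Fin n → ℝ) → Fin n → ℝ) (x y : Fin n → ℝ) : ℝ :=
  ∑ i, b x y i * y i

/-- The coordinate form of an h-vector: `b_i|_j = 0` and `L C^h_ij b_h = ρ h_ij`. -/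
structure IsCoordHVector (Ω : Set ((Fin n → ℝ) × (Fin n → ℝ))) (L : Scalar n)
    (b : (Fin n → ℝ) → (Fin n → ℝ) → Fin n → ℝ) (ρ : Scalar n) : Prop where
  smooth : ∀ i, SmoothScalarOn Ω (fun x y => b x y i)
  vCov_eq_zero : ∀ x y, (x, y) ∈ Ω → ∀ i j, vCov L b i j x y = 0
  cartan : ∀ x y, (x, y) ∈ Ω → ∀ i j,
    L x y * ∑ h, cartanTensorUp L h i j x y * b x y h = ρ x y * angular L i j x y

theorem smoothScalarOn_pairing (hb : ∀ i, SmoothScalarOn Ω (fun x y => b x y i)) :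
    SmoothScalarOn Ω (pairing b) :=
  SmoothScalarOn.sum fun i _ => (hb i).mul (smoothScalarOn_coord i)

/-- An h-vector depends on the supporting element only through `∂b_i/∂yʲ = (ρ / L) h_ij`. -/
theorem IsCoordHVector.dY_eq (hL : IsCoordFinsler Ω L) (hb : IsCoordHVector Ω L b ρ)
    (h : (x, y) ∈ Ω) (i j : Fin n) :
    dY j (fun x y => b x y i) x y = ρ x y * dY i (dY j L) x y := by
  have h1 := hb.vCov_eq_zero x y h i j
  have h2 := hb.cartan x y h i j
  have h3 := hL.pos x y h
  rw [vCov, sub_eq_zero] at h1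
  rw [h1]
  rw [angular] at h2
  apply mul_left_cancel₀ h3.ne'
  rw [h2]; ring

/-- `h_ij yʲ = 0`, up to the factor `L`. -/
theorem IsCoordFinsler.sum_mul_dY_dY (hL : IsCoordFinsler Ω L) (h : (x, y) ∈ Ω) (k : Fin n) :
    ∑ i, y i * dY i (dY k L) x y = 0 := by
  have h1 : HomogOn Ω 0 (dY k L) := HomogOn.dY hL.isOpen hL.homog k
  simpa using h1.euler hL.isOpen (hL.smooth.dY hL.isOpen k) h

/-- `∂β/∂yᵏ = b_k`: the part of `∂β/∂yᵏ` coming from the dependence of `b` on `y` vanishes because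
`h_ij yʲ = 0`. -/
theorem IsCoordHVector.dY_pairing (hL : IsCoordFinsler Ω L) (hb : IsCoordHVector Ω L b ρ)
    (h : (x, y) ∈ Ω) (k : Fin n) : dY k (pairing b) x y = b x y k := by
  have h1 : dY k (pairing b) x y
      = ∑ i, dY k (fun x y => (fun x y => b x y i) x y * (fun _ y => y i) x y) x y :=
    dY_sum hL.isOpen (fun i _ => (hb.smooth i).mul (smoothScalarOn_coord i)) h k
  have h2 : ∀ i, dY k (fun x y => (fun x y => b x y i) x y * (fun _ y => y i) x y) x y
      = b x y i * (if i = k then 1 else 0) + ρ x y * (y i * dY i (dY k L) x y) := fun i => by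
    rw [dY_mul hL.isOpen (hb.smooth i) (smoothScalarOn_coord i) h, dY_coord, hb.dY_eq hL h]
    ring
  rw [h1, Finset.sum_congr rfl fun i _ => h2 i, Finset.sum_add_distrib, ← Finset.mul_sum,
    hL.sum_mul_dY_dY h]
  simp

theorem IsCoordFinsler.cartanConn_symm (hL : IsCoordFinsler Ω L) (h : (x, y) ∈ Ω)
    (i j k : Fin n) : cartanConn L i j k x y = cartanConn L i k j x y := by
  have hd : ∀ a c d, delta L a (fun x' y' => metric L x' y' c d) x y
      = delta L a (fun x' y' => metric L x' y' d c) x y := fun a c d => by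
    simp only [delta]
    rw [dX_congr hL.isOpen (fun _ _ h' => hL.metric_symm h' c d) h]
    simp only [dY_congr hL.isOpen (fun _ _ h' => hL.metric_symm h' c d) h]
  simp only [cartanConn]
  congr 1
  refine Finset.sum_congr rfl fun r _ => ?_
  rw [hd j r k, hd k j r, hd r j k]
  ring

/-- For a gradient h-vector, `β` satisfies the Euler–Lagrange equation along the spray of `L`:
the Euler–Lagrange expression is `yʲ (b_{i|j} - b_{j|i})`, in which the connection coefficients
cancel by symmetry. -/
theorem IsCoordHVector.eulerLagrange_pairing (hL : IsCoordFinsler Ω L)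
    (hb : IsCoordHVector Ω L b ρ) (h : (x, y) ∈ Ω)
    (hgrad : ∀ i j, hCov L b i j x y = hCov L b j i x y) (i : Fin n) :
    eulerLagrange L (pairing b) i x y = 0 := by
  have h1 : ∑ j, (hCov L b i j x y) * y j = ∑ j, (hCov L b j i x y) * y j := by
    simp only [hgrad i]
  have h2 : ∑ j, (hCov L b i j x y) * y j = ∑ j, y j * dX j (fun x y => b x y i) x y
      - 2 * ∑ s, sprayCoeff L s x y * dY s (fun x y => b x y i) x y
      - ∑ j, (∑ r, cartanConn L r i j x y * b x y r) * y j := by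
    simp only [hCov, sub_mul, Finset.sum_sub_distrib]
    congr 1
    congr 1
    · exact Finset.sum_congr rfl fun j _ => mul_comm _ _
    · simp only [Finset.sum_mul]
      rw [Finset.sum_comm, Finset.mul_sum]
      refine Finset.sum_congr rfl fun s _ => ?_
      rw [← mul_assoc, ← hL.nonlinConn_mul h, Finset.sum_mul]
      exact Finset.sum_congr rfl fun j _ => by ring
  have h3 : ∑ j, (hCov L b j i x y) * y j = dX i (pairing b) x y
      - ∑ j, (∑ r, cartanConn L r i j x y * b x y r) * y j := by
    simp only [hCov, sub_mul, Finset.sum_sub_distrib]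
    -- `yʲ ∂b_j/∂yˢ = 0`, because `∂b_j/∂yˢ` is proportional to `h_js`.
    have h4 : ∑ j, (∑ s, dY s (fun x y => b x y j) x y * nonlinConn L s i x y) * y j = 0 := by
      simp only [Finset.sum_mul]
      rw [Finset.sum_comm]
      refine Finset.sum_eq_zero fun s _ => ?_
      have h5 := hL.sum_mul_dY_dY h s
      calc _ = (ρ x y * nonlinConn L s i x y) * ∑ j, y j * dY j (dY s L) x y := by
            rw [Finset.mul_sum]
            refine Finset.sum_congr rfl fun j _ => ?_
            rw [hb.dY_eq hL h]; ring
        _ = 0 := by rw [h5, mul_zero]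
    have h6 : dX i (pairing b) x y = ∑ j, dX i (fun x y => b x y j) x y * y j :=
      dX_sum_mul_coord hL.isOpen hb.smooth h i
    rw [h4, h6, sub_zero]
    simp only [hL.cartanConn_symm h _ i]
  have h7 : eulerLagrange L (pairing b) i x y = ∑ j, y j * dX j (fun x y => b x y i) x y
      - 2 * ∑ s, sprayCoeff L s x y * dY s (fun x y => b x y i) x y
      - dX i (pairing b) x y := by
    rw [eulerLagrange_eq hL.isOpen (smoothScalarOn_pairing hb.smooth) h]
    have hc : ∀ x y, (x, y) ∈ Ω → dY i (pairing b) x y = (fun x y => b x y i) x y :=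
      fun x y h => hb.dY_pairing hL h i
    simp only [dX_congr hL.isOpen hc h, dY_congr hL.isOpen hc h]
  linarith

/-- A derivative of `*L² = L⁴/β²` is a combination of those of `L²` and `β`. -/
theorem dirDeriv_sqL_kropina (hL : IsCoordFinsler Ω L) (hK : IsCoordFinsler Ω K)
    (hb : ∀ i, SmoothScalarOn Ω (fun x y => b x y i))
    (hβ : ∀ x y, (x, y) ∈ Ω → pairing b x y ≠ 0)
    (hKL : ∀ x y, (x, y) ∈ Ω → K x y = L x y ^ 2 / pairing b x y) (h : (x, y) ∈ Ω) (ξ) :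
    dirDeriv ξ (sqL K) x y
      = 2 * sqL L x y / pairing b x y ^ 2 * dirDeriv ξ (sqL L) x y
        + -2 * sqL K x y / pairing b x y * dirDeriv ξ (pairing b) x y := by
  have hP := hL.smooth_sqL
  have hQ := hK.smooth_sqL
  have hB := smoothScalarOn_pairing hb
  -- Differentiating `*L² β² = (L²)²` avoids the quotient rule.
  have e : ∀ x y, (x, y) ∈ Ω →
      (fun x y => sqL K x y * (fun x y => pairing b x y * pairing b x y) x y) x y
      = (fun x y => sqL L x y * sqL L x y) x y := fun x y h => by
    have := hβ x y h
    simp only [sqL, hKL x y h]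
    field_simp
  have h1 := dirDeriv_congr hL.isOpen e h ξ
  rw [dirDeriv_mul hL.isOpen hQ (hB.mul hB) h, dirDeriv_mul hL.isOpen hB hB h,
    dirDeriv_mul hL.isOpen hP hP h] at h1
  have h2 := hβ x y h
  field_simp
  linarith

theorem smoothScalarOn_kropina_coeff (hL : IsCoordFinsler Ω L)
    (hb : ∀ i, SmoothScalarOn Ω (fun x y => b x y i))
    (hβ : ∀ x y, (x, y) ∈ Ω → pairing b x y ≠ 0) :
    SmoothScalarOn Ω (fun x y => 2 * sqL L x y / pairing b x y ^ 2) :=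
  ContDiffOn.div (ContDiffOn.mul contDiffOn_const hL.smooth_sqL)
    (ContDiffOn.pow (smoothScalarOn_pairing hb) 2) fun _ hz => pow_ne_zero 2 (hβ _ _ hz)

theorem smoothScalarOn_kropina_coeff' (hK : IsCoordFinsler Ω K)
    (hb : ∀ i, SmoothScalarOn Ω (fun x y => b x y i))
    (hβ : ∀ x y, (x, y) ∈ Ω → pairing b x y ≠ 0) :
    SmoothScalarOn Ω (fun x y => -2 * sqL K x y / pairing b x y) :=
  ContDiffOn.div (ContDiffOn.mul contDiffOn_const hK.smooth_sqL)
    (smoothScalarOn_pairing hb) fun _ hz => hβ _ _ hz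

/-- Second derivatives of `*L²`: modulo `∂L²/∂yⁱ` and `b_i = ∂β/∂yⁱ` they are a combination of
those of `L²` and `β`, with coefficients independent of `i`. -/
theorem exists_dirDeriv_dY_sqL_kropina (hL : IsCoordFinsler Ω L) (hK : IsCoordFinsler Ω K)
    (hb : IsCoordHVector Ω L b ρ)
    (hβ : ∀ x y, (x, y) ∈ Ω → pairing b x y ≠ 0)
    (hKL : ∀ x y, (x, y) ∈ Ω → K x y = L x y ^ 2 / pairing b x y) (h : (x, y) ∈ Ω) (ξ) :
    ∃ σ τ : ℝ, ∀ i, dirDeriv ξ (dY i (sqL K)) x y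
      = 2 * sqL L x y / pairing b x y ^ 2 * dirDeriv ξ (dY i (sqL L)) x y
        + -2 * sqL K x y / pairing b x y * dirDeriv ξ (dY i (pairing b)) x y
        + σ * dY i (sqL L) x y + τ * b x y i := by
  have hΩ := hL.isOpen
  have hP := hL.smooth_sqL
  have hQ := hK.smooth_sqL
  have hB := smoothScalarOn_pairing hb.smooth
  have ha := smoothScalarOn_kropina_coeff hL hb.smooth hβ
  have hc := smoothScalarOn_kropina_coeff' hK hb.smooth hβ
  refine ⟨dirDeriv ξ (fun x y => 2 * sqL L x y / pairing b x y ^ 2) x y,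
    dirDeriv ξ (fun x y => -2 * sqL K x y / pairing b x y) x y, fun i => ?_⟩
  have e : ∀ x y, (x, y) ∈ Ω → dY i (sqL K) x y
      = (fun x y => (fun x y => (fun x y => 2 * sqL L x y / pairing b x y ^ 2) x y
            * dY i (sqL L) x y) x y
        + (fun x y => (fun x y => -2 * sqL K x y / pairing b x y) x y
            * dY i (pairing b) x y) x y) x y := fun x y h => by
    simp only [dY_eq_dirDeriv hΩ hP h, dY_eq_dirDeriv hΩ hQ h, dY_eq_dirDeriv hΩ hB h]
    exact dirDeriv_sqL_kropina hL hK hb.smooth hβ hKL h _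
  rw [dirDeriv_congr hΩ e h, dirDeriv_add hΩ (ha.mul (hP.dY hΩ i)) (hc.mul (hB.dY hΩ i)) h,
    dirDeriv_mul hΩ ha (hP.dY hΩ i) h, dirDeriv_mul hΩ hc (hB.dY hΩ i) h, hb.dY_pairing hL h]
  ring

/-- Along the spray of `L`, the Euler–Lagrange covector of `*L²` is a combination of
`∂L²/∂yⁱ` and `b_i`. -/
theorem exists_eulerLagrange_sqL_kropina (hL : IsCoordFinsler Ω L) (hK : IsCoordFinsler Ω K)
    (hb : IsCoordHVector Ω L b ρ)
    (hβ : ∀ x y, (x, y) ∈ Ω → pairing b x y ≠ 0)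
    (hKL : ∀ x y, (x, y) ∈ Ω → K x y = L x y ^ 2 / pairing b x y) (h : (x, y) ∈ Ω)
    (hgrad : ∀ i j, hCov L b i j x y = hCov L b j i x y) :
    ∃ σ τ : ℝ, ∀ i, eulerLagrange L (sqL K) i x y = σ * dY i (sqL L) x y + τ * b x y i := by
  obtain ⟨σ, τ, hστ⟩ := exists_dirDeriv_dY_sqL_kropina hL hK hb hβ hKL h (sprayVec L x y)
  refine ⟨σ, τ, fun i => ?_⟩
  have h1 := hL.eulerLagrange_sqL h i
  have h2 := hb.eulerLagrange_pairing hL h hgrad i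
  have hΩ := hL.isOpen
  have h3 : dX i (sqL K) x y
      = 2 * sqL L x y / pairing b x y ^ 2 * dX i (sqL L) x y
        + -2 * sqL K x y / pairing b x y * dX i (pairing b) x y := by
    simp only [dX_eq_dirDeriv hΩ hL.smooth_sqL h, dX_eq_dirDeriv hΩ hK.smooth_sqL h,
      dX_eq_dirDeriv hΩ (smoothScalarOn_pairing hb.smooth) h]
    exact dirDeriv_sqL_kropina hL hK hb.smooth hβ hKL h _
  rw [eulerLagrange, sub_eq_zero] at h1 h2
  rw [eulerLagrange, hστ, h3, h1, h2]
  ring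

/-- `∂L²/∂yⁱ∂yʲ = 2 (∂L/∂yⁱ ∂L/∂yʲ + L ∂²L/∂yⁱ∂yʲ)`, solved for the Hessian of `L`. -/
theorem IsCoordFinsler.mul_dY_dY (hL : IsCoordFinsler Ω L) (h : (x, y) ∈ Ω) (i j : Fin n) :
    L x y * dY i (dY j L) x y = metric L x y i j - dY i L x y * dY j L x y := by
  have e : ∀ x y, (x, y) ∈ Ω → dY j (sqL L) x y
      = (fun x y => (fun _ _ => (2 : ℝ)) x y * (fun x y => L x y * dY j L x y) x y) x y :=
    fun x y h => by
      have : dY j (sqL L) x y = dY j (fun x y => L x y * L x y) x y := by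
        congr 1; funext x y; exact sq _
      rw [this, dY_mul hL.isOpen hL.smooth hL.smooth h]
      ring
  have hc : dY i (fun _ _ => (2 : ℝ)) x y = 0 := by simp [dY]
  have hd := hL.smooth.dY hL.isOpen j
  rw [metric, Matrix.of_apply, dY_congr hL.isOpen e h,
    dY_mul hL.isOpen (smoothScalarOn_const 2) (hL.smooth.mul hd) h,
    dY_mul hL.isOpen hL.smooth hd h, hc]
  ring

theorem IsCoordFinsler.dY_sqL (hL : IsCoordFinsler Ω L) (h : (x, y) ∈ Ω) (j : Fin n) :
    dY j (sqL L) x y = 2 * L x y * dY j L x y := by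
  have : dY j (sqL L) x y = dY j (fun x y => L x y * L x y) x y := by
    congr 1; funext x y; exact sq _
  rw [this, dY_mul hL.isOpen hL.smooth hL.smooth h]
  ring

/-- On vectors orthogonal to both `∂L²/∂yⁱ` and `b_i`, the metric tensor of the Kropina change is
conformal to that of `L`. -/
theorem exists_metric_kropina_mulVec (hL : IsCoordFinsler Ω L) (hK : IsCoordFinsler Ω K)
    (hb : IsCoordHVector Ω L b ρ)
    (hβ : ∀ x y, (x, y) ∈ Ω → pairing b x y ≠ 0)
    (hKL : ∀ x y, (x, y) ∈ Ω → K x y = L x y ^ 2 / pairing b x y) (h : (x, y) ∈ Ω) :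
    ∃ κ : ℝ, ∀ N : Fin n → ℝ, ∑ i, dY i (sqL L) x y * N i = 0 → ∑ i, b x y i * N i = 0 →
      metric K x y *ᵥ N = κ • (metric L x y *ᵥ N) := by
  have hΩ := hL.isOpen
  have hpos := hL.pos x y h
  refine ⟨2 * sqL L x y / pairing b x y ^ 2
    + -2 * sqL K x y / pairing b x y * ρ x y / (2 * L x y), fun N hN hbN => ?_⟩
  funext j
  obtain ⟨σ, τ, hστ⟩ := exists_dirDeriv_dY_sqL_kropina hL hK hb hβ hKL h (0, Pi.single j 1)
  have hN' : ∑ i, dY i L x y * N i = 0 := by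
    simp only [hL.dY_sqL h, mul_assoc, ← Finset.mul_sum] at hN
    simpa [hpos.ne'] using hN
  have hc : ∀ i x y, (x, y) ∈ Ω → dY i (pairing b) x y = (fun x y => b x y i) x y :=
    fun i x y h => hb.dY_pairing hL h i
  have h1 : ∀ i, metric K x y j i = 2 * sqL L x y / pairing b x y ^ 2 * metric L x y j i
      + -2 * sqL K x y / pairing b x y * ρ x y / (2 * L x y)
        * (metric L x y j i - dY i L x y * dY j L x y)
      + σ / 2 * dY i (sqL L) x y + τ / 2 * b x y i := fun i => by
    have h2 := hστ i
    rw [← dY_eq_dirDeriv hΩ (hK.smooth_sqL.dY hΩ i) h,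
      ← dY_eq_dirDeriv hΩ (hL.smooth_sqL.dY hΩ i) h,
      ← dY_eq_dirDeriv hΩ ((smoothScalarOn_pairing hb.smooth).dY hΩ i) h,
      dY_congr hΩ (hc i) h, hb.dY_eq hL h] at h2
    have h3 := hL.mul_dY_dY h i j
    rw [hL.metric_symm h i j] at h3
    rw [← h3]
    simp only [metric, Matrix.of_apply]
    rw [h2]
    field_simp
  change ∑ i, metric K x y j i * N i = _ * ∑ i, metric L x y j i * N i
  set A := 2 * sqL L x y / pairing b x y ^ 2
  set B := -2 * sqL K x y / pairing b x y * ρ x y / (2 * L x y)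
  calc ∑ i, metric K x y j i * N i
      = (A + B) * ∑ i, metric L x y j i * N i - B * dY j L x y * ∑ i, dY i L x y * N i
        + σ / 2 * ∑ i, dY i (sqL L) x y * N i + τ / 2 * ∑ i, b x y i * N i := by
        simp only [Finset.mul_sum, ← Finset.sum_sub_distrib, ← Finset.sum_add_distrib]
        refine Finset.sum_congr rfl fun i _ => ?_
        rw [h1]; ring
    _ = _ := by rw [hN, hN', hbN]; ring

end Kropina

/-! ### Orthogonal decomposition along an immersion -/

section NormalPart

variable {n m : ℕ} {A : Matrix (Fin n) (Fin n) ℝ} {B : Matrix (Fin n) (Fin m) ℝ}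

/-- The component of `w` orthogonal, for the inner product `A`, to the range of `B`. -/
noncomputable def normalPart (A : Matrix (Fin n) (Fin n) ℝ) (B : Matrix (Fin n) (Fin m) ℝ)
    (w : Fin n → ℝ) : Fin n → ℝ :=
  w - B *ᵥ ((Bᵀ * A * B)⁻¹ *ᵥ (Bᵀ *ᵥ (A *ᵥ w)))

theorem isUnit_det_gram (hA : A.PosDef) (hB : Function.Injective B.mulVec) :
    IsUnit (Bᵀ * A * B).det := by
  have := (hA.conjTranspose_mul_mul_same hB).isUnit
  rw [Matrix.conjTranspose_eq_transpose_of_trivial] at this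
  exact (Matrix.isUnit_iff_isUnit_det _).1 this

theorem transpose_mulVec_normalPart (hA : A.PosDef) (hB : Function.Injective B.mulVec)
    (w : Fin n → ℝ) : Bᵀ *ᵥ (A *ᵥ normalPart A B w) = 0 := by
  rw [normalPart, Matrix.mulVec_sub, Matrix.mulVec_sub, sub_eq_zero]
  simp only [Matrix.mulVec_mulVec, ← Matrix.mul_assoc]
  rw [Matrix.mul_nonsing_inv _ (isUnit_det_gram hA hB), Matrix.one_mul]

theorem mulVec_dotProduct_comm (hA : Aᵀ = A) (v w : Fin n → ℝ) :
    (A *ᵥ v) ⬝ᵥ w = (A *ᵥ w) ⬝ᵥ v := by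
  rw [dotProduct_comm (A *ᵥ w), Matrix.dotProduct_mulVec, ← Matrix.mulVec_transpose, hA]

theorem dotProduct_normalPart {N : Fin n → ℝ} (hN : Bᵀ *ᵥ (A *ᵥ N) = 0) (w : Fin n → ℝ) :
    (A *ᵥ N) ⬝ᵥ normalPart A B w = (A *ᵥ N) ⬝ᵥ w := by
  rw [normalPart, dotProduct_sub, Matrix.dotProduct_mulVec, ← Matrix.mulVec_transpose, hN,
    zero_dotProduct, sub_zero]

theorem mulVec_dotProduct_self_pos (hA : A.PosDef) {v : Fin n → ℝ} (hv : v ≠ 0) :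
    0 < (A *ᵥ v) ⬝ᵥ v := by
  rw [dotProduct_comm]; simpa using hA.dotProduct_mulVec_pos hv

theorem normalPart_eq_zero_iff (hA : A.PosDef) (hB : Function.Injective B.mulVec)
    (w : Fin n → ℝ) :
    normalPart A B w = 0 ↔ ∀ N : Fin n → ℝ, Bᵀ *ᵥ (A *ᵥ N) = 0 → (A *ᵥ N) ⬝ᵥ w = 0 := by
  constructor
  · intro h N hN
    rw [← dotProduct_normalPart hN w, h, dotProduct_zero]
  · intro h
    by_contra h0
    have h1 := transpose_mulVec_normalPart hA hB w
    have h2 := h _ h1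
    rw [← dotProduct_normalPart h1] at h2
    exact (mulVec_dotProduct_self_pos hA h0).ne' h2

/-- If a second inner product `A'` is conformal to `A` on the normal space of `B` for `A`, the two
normal spaces agree: the tangential component of an `A'`-normal vector is itself `A'`-normal. -/
theorem normal_of_normal {A' : Matrix (Fin n) (Fin n) ℝ} (hA : A.PosDef) (hA' : A'.PosDef)
    (hB : Function.Injective B.mulVec) {κ : ℝ}
    (hκ : ∀ N : Fin n → ℝ, Bᵀ *ᵥ (A *ᵥ N) = 0 → A' *ᵥ N = κ • (A *ᵥ N))
    {N : Fin n → ℝ} (hN : Bᵀ *ᵥ (A' *ᵥ N) = 0) : Bᵀ *ᵥ (A *ᵥ N) = 0 := by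
  set c := (Bᵀ * A * B)⁻¹ *ᵥ (Bᵀ *ᵥ (A *ᵥ N)) with hc
  have h1 := transpose_mulVec_normalPart hA hB N
  have h2 : Bᵀ *ᵥ (A' *ᵥ normalPart A B N) = 0 := by
    rw [hκ _ h1, Matrix.mulVec_smul, h1, smul_zero]
  have h3 : N = normalPart A B N + B *ᵥ c := by rw [normalPart, sub_add_cancel]
  have h4 : Bᵀ *ᵥ (A' *ᵥ (B *ᵥ c)) = 0 := by
    rw [h3, Matrix.mulVec_add, Matrix.mulVec_add, h2, zero_add] at hN
    exact hN
  have h5 : B *ᵥ c = 0 := by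
    by_contra h0
    have := mulVec_dotProduct_self_pos hA' h0
    rw [Matrix.dotProduct_mulVec, ← Matrix.mulVec_transpose, h4, zero_dotProduct] at this
    exact lt_irrefl _ this
  rw [h5, add_zero] at h3
  rw [h3]; exact h1

end NormalPart

/-! ### Hypersurfaces in coordinates -/

section Hypersurface

variable {n m : ℕ} {Ω : Set ((Fin n → ℝ) × (Fin n → ℝ))} {L : Scalar n}
  {U : Set (Fin m → ℝ)} {X : (Fin m → ℝ) → (Fin n → ℝ)} {u v : Fin m → ℝ}

/-- A parametrization `X` that is a smooth immersion on the open set `U`. -/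
structure IsCoordImmersion (U : Set (Fin m → ℝ)) (X : (Fin m → ℝ) → (Fin n → ℝ)) : Prop where
  isOpen : IsOpen U
  smooth : ContDiffOn ℝ ∞ X U
  injective : ∀ u ∈ U, Function.Injective (fderiv ℝ X u)

/-- The line elements `(u, v)` over `U` with supporting element in `Ω`. -/
def coordLineElements (U : Set (Fin m → ℝ)) (X : (Fin m → ℝ) → (Fin n → ℝ))
    (Ω : Set ((Fin n → ℝ) × (Fin n → ℝ))) : Set ((Fin m → ℝ) × (Fin m → ℝ)) :=
  {z | z.1 ∈ U ∧ (X z.1, support X z.1 z.2) ∈ Ω}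

theorem proj_mulVec (X : (Fin m → ℝ) → (Fin n → ℝ)) (u v : Fin m → ℝ) :
    proj X u *ᵥ v = fderiv ℝ X u v := by
  conv_rhs => rw [pi_eq_sum_univ' v, map_sum]
  funext i
  simp [Matrix.mulVec, dotProduct, proj, Finset.sum_apply, mul_comm]

theorem support_eq (X : (Fin m → ℝ) → (Fin n → ℝ)) (u v : Fin m → ℝ) :
    support X u v = fderiv ℝ X u v := proj_mulVec X u v

theorem IsCoordImmersion.proj_injective (hX : IsCoordImmersion U X) (hu : u ∈ U) :
    Function.Injective (proj X u).mulVec := by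
  intro v w h
  simp only [proj_mulVec] at h
  exact hX.injective u hu h

theorem IsCoordImmersion.contDiffOn_proj (hX : IsCoordImmersion U X) (i : Fin n) (α : Fin m) :
    ContDiffOn ℝ ∞ (fun u => proj X u i α) U := by
  have h1 : ContDiffOn ℝ ∞ (fun u => fderiv ℝ X u (Pi.single α 1)) U :=
    (hX.smooth.fderiv_of_isOpen (m := ∞) hX.isOpen (by simp)).clm_apply contDiffOn_const
  exact contDiffOn_pi.1 h1 i

theorem IsCoordImmersion.contDiffOn_proj₂ (hX : IsCoordImmersion U X) (i : Fin n)
    (α β : Fin m) : ContDiffOn ℝ ∞ (fun u => proj₂ X u i α β) U :=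
  ((hX.contDiffOn_proj i α).fderiv_of_isOpen (m := ∞) hX.isOpen (by simp)).clm_apply
    contDiffOn_const

theorem smoothScalarOn_of_contDiffOn {Λ : Set ((Fin m → ℝ) × (Fin m → ℝ))}
    {g : (Fin m → ℝ) → ℝ} (hg : ContDiffOn ℝ ∞ g U) (hΛ : ∀ z ∈ Λ, z.1 ∈ U) :
    SmoothScalarOn Λ (fun u _ => g u) :=
  hg.comp (t := U) (f := Prod.fst) contDiffOn_fst hΛ

theorem IsCoordImmersion.contDiffOn_lift (hX : IsCoordImmersion U X) :
    ContDiffOn ℝ ∞ (fun z : (Fin m → ℝ) × (Fin m → ℝ) => (X z.1, support X z.1 z.2))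
      (U ×ˢ Set.univ) := by
  have h1 : ContDiffOn ℝ ∞ (fun z : (Fin m → ℝ) × (Fin m → ℝ) => X z.1) (U ×ˢ Set.univ) :=
    hX.smooth.comp contDiffOn_fst fun z hz => hz.1
  refine h1.prodMk ?_
  simp only [support_eq]
  exact ((hX.smooth.fderiv_of_isOpen (m := ∞) hX.isOpen (by simp)).comp contDiffOn_fst
    fun z hz => hz.1).clm_apply contDiffOn_snd

theorem IsCoordImmersion.isOpen_coordLineElements (hX : IsCoordImmersion U X) (hΩ : IsOpen Ω) :
    IsOpen (coordLineElements U X Ω) := by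
  have := hX.contDiffOn_lift.continuousOn.isOpen_inter_preimage
    (hX.isOpen.prod isOpen_univ) hΩ
  have e : coordLineElements U X Ω = U ×ˢ Set.univ ∩
      (fun z : (Fin m → ℝ) × (Fin m → ℝ) => (X z.1, support X z.1 z.2)) ⁻¹' Ω := by
    ext z
    simp [coordLineElements]
  rwa [e]

theorem IsCoordImmersion.smooth_comp (hX : IsCoordImmersion U X) {f : Scalar n}
    (hf : SmoothScalarOn Ω f) :
    SmoothScalarOn (coordLineElements U X Ω) (fun u v => f (X u) (support X u v)) :=
  ContDiffOn.comp (t := Ω) (f := fun z : (Fin m → ℝ) × (Fin m → ℝ) => (X z.1, support X z.1 z.2))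
    hf (hX.contDiffOn_lift.mono fun _ hz => ⟨hz.1, trivial⟩) fun _ hz => hz.2

theorem dY_comp_support {f : Scalar n} (hΩ : IsOpen Ω) (hf : SmoothScalarOn Ω f)
    (h : (u, v) ∈ coordLineElements U X Ω) (α : Fin m) :
    dY α (fun u v => f (X u) (support X u v)) u v
      = ∑ j, proj X u j α * dY j f (X u) (support X u v) := by
  have h1 : HasFDerivAt (fun v => support X u v) (fderiv ℝ X u) v := by
    simp only [support_eq]; exact (fderiv ℝ X u).hasFDerivAt
  have h2 := ((hf.differentiableAt_snd hΩ h.2).hasFDerivAt.comp v h1).fderiv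
  change fderiv ℝ ((fun y => f (X u) y) ∘ fun v => support X u v) v _ = _
  rw [h2]
  change fderiv ℝ (fun y => f (X u) y) (support X u v) (fderiv ℝ X u (Pi.single α 1)) = _
  conv_lhs => rw [pi_eq_sum_univ' (fderiv ℝ X u (Pi.single α 1)), map_sum]
  simp only [map_smul, smul_eq_mul]
  rfl

/-- The metric tensor of the hypersurface is `g_αβ = g_ij B^i_α B^j_β`. -/
theorem IsCoordImmersion.metric_inducedL (hX : IsCoordImmersion U X) (hL : IsCoordFinsler Ω L)
    (h : (u, v) ∈ coordLineElements U X Ω) :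
    metric (inducedL L X) u v = (proj X u)ᵀ * metric L (X u) (support X u v) * proj X u := by
  have hΛ := hX.isOpen_coordLineElements hL.isOpen
  have hp : ∀ j β, SmoothScalarOn (coordLineElements U X Ω) (fun u _ => proj X u j β) :=
    fun j β => smoothScalarOn_of_contDiffOn (hX.contDiffOn_proj j β) fun _ hz => hz.1
  have hs := hL.smooth_sqL
  ext α β
  have e : ∀ u v, (u, v) ∈ coordLineElements U X Ω → dY β (sqL (inducedL L X)) u v
      = (fun u v => ∑ j, (fun u v => (fun u _ => proj X u j β) u v *
          (fun u v => dY j (sqL L) (X u) (support X u v)) u v) u v) u v :=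
    fun u v h => dY_comp_support hL.isOpen hs h β
  have hd : ∀ j, SmoothScalarOn (coordLineElements U X Ω)
      (fun u v => dY j (sqL L) (X u) (support X u v)) :=
    fun j => hX.smooth_comp (hs.dY hL.isOpen j)
  rw [metric, Matrix.of_apply, dY_congr hΛ e h, dY_sum hΛ (fun j _ => (hp j β).mul (hd j)) h]
  have hc : ∀ j, dY α (fun u _ => proj X u j β) u v = 0 := fun j => by simp [dY]
  simp only [dY_mul hΛ (hp _ _) (hd _) h, hc, mul_zero, add_zero,
    dY_comp_support hL.isOpen (hs.dY hL.isOpen _) h, Matrix.mul_apply, Matrix.transpose_apply,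
    metric, Matrix.of_apply, Finset.mul_sum, Finset.sum_mul]
  refine Finset.sum_congr rfl fun j _ => Finset.sum_congr rfl fun i _ => ?_
  ring

theorem IsCoordImmersion.smooth_gaussTerm (hX : IsCoordImmersion U X) (hL : IsCoordFinsler Ω L)
    (i : Fin n) (α : Fin m) : SmoothScalarOn (coordLineElements U X Ω) (gaussTerm L X i α) :=
  (SmoothScalarOn.sum fun β _ => (smoothScalarOn_of_contDiffOn (hX.contDiffOn_proj₂ i β α)
    fun _ hz => hz.1).mul (smoothScalarOn_coord β)).add
  (SmoothScalarOn.sum fun j _ => (hX.smooth_comp (hL.smooth_nonlinConn i j)).mul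
    (smoothScalarOn_of_contDiffOn (hX.contDiffOn_proj j α) fun _ hz => hz.1))

theorem IsCoordImmersion.smooth_inducedConn (hX : IsCoordImmersion U X)
    (hL : IsCoordFinsler Ω L) (α β : Fin m) :
    SmoothScalarOn (coordLineElements U X Ω) (inducedConn L X α β) := by
  have hΛ := hX.isOpen_coordLineElements hL.isOpen
  have hs : SmoothScalarOn (coordLineElements U X Ω) (sqL (inducedL L X)) :=
    hX.smooth_comp hL.smooth_sqL
  have hg : ∀ α β, SmoothScalarOn (coordLineElements U X Ω)
      (fun u v => metric (inducedL L X) u v α β) := fun α β =>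
    (smoothScalarOn_const _).mul ((hs.dY hΛ β).dY hΛ α)
  have hinv : ∀ α β, SmoothScalarOn (coordLineElements U X Ω)
      (fun u v => metricInv (inducedL L X) u v α β) := smoothScalarOn_inv hg fun u v h => by
    rw [hX.metric_inducedL hL h]
    exact (isUnit_det_gram (hL.posDef _ _ h.2) (hX.proj_injective h.1)).ne_zero
  exact SmoothScalarOn.sum fun i _ => (SmoothScalarOn.sum fun γ _ => SmoothScalarOn.sum fun j _ =>
    ((hinv α γ).mul (hX.smooth_comp (hL.smooth_metric i j))).mul
      (smoothScalarOn_of_contDiffOn (hX.contDiffOn_proj j γ) fun _ hz => hz.1)).mul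
    (hX.smooth_gaussTerm hL i β)

/-- The vector `(B^i_0α + G^i_j B^j_α) v^α`, the acceleration of the hypersurface in direction `v`
relative to the ambient paths. -/
noncomputable def gaussVec (L : Scalar n) (X : (Fin m → ℝ) → (Fin n → ℝ)) (u v : Fin m → ℝ) :
    Fin n → ℝ :=
  fun i => ∑ α, gaussTerm L X i α u v * v α

theorem gaussVec_apply (L : Scalar n) (X : (Fin m → ℝ) → (Fin n → ℝ)) (u v : Fin m → ℝ)
    (i : Fin n) : gaussVec L X u v i = (∑ α, ∑ β, proj₂ X u i β α * v β * v α)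
      + ∑ j, nonlinConn L i j (X u) (support X u v) * support X u v j := by
  simp only [gaussVec, gaussTerm, add_mul, Finset.sum_add_distrib, Finset.sum_mul]
  congr 1
  rw [Finset.sum_comm]
  refine Finset.sum_congr rfl fun j _ => ?_
  conv_rhs => rw [support, Matrix.mulVec, dotProduct, Finset.mul_sum]
  exact Finset.sum_congr rfl fun α _ => mul_assoc _ _ _

theorem isNormal_iff {N : Fin n → ℝ} :
    IsNormal L X u v N ↔ (proj X u)ᵀ *ᵥ (metric L (X u) (support X u v) *ᵥ N) = 0 := by
  rw [funext_iff]
  refine forall_congr' fun α => ?_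
  have : ((proj X u)ᵀ *ᵥ (metric L (X u) (support X u v) *ᵥ N)) α
      = ∑ i, ∑ j, metric L (X u) (support X u v) i j * proj X u i α * N j := by
    simp only [Matrix.mulVec, dotProduct, Matrix.transpose_apply, Finset.mul_sum]
    exact Finset.sum_congr rfl fun i _ => Finset.sum_congr rfl fun j _ => by ring
  rw [this, Pi.zero_apply]

theorem normalCurvature₀_eq (N : Fin n → ℝ) : normalCurvature₀ L X N u v
    = (metric L (X u) (support X u v) *ᵥ N) ⬝ᵥ gaussVec L X u v := by
  simp only [normalCurvature₀, normalCurvature, gaussVec, dotProduct, Finset.sum_mul,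
    Finset.mul_sum, Matrix.mulVec]
  rw [Finset.sum_comm]
  simp only [mul_assoc]

theorem sum_metric_eq (N : Fin n → ℝ) :
    ∑ i, ∑ j, metric L (X u) (support X u v) i j * N i * N j
      = (metric L (X u) (support X u v) *ᵥ N) ⬝ᵥ N := by
  simp only [Matrix.mulVec, dotProduct, Finset.sum_mul]
  exact Finset.sum_congr rfl fun i _ => Finset.sum_congr rfl fun j _ => by ring

/-- A linear condition on unit normals extends to all normals by rescaling. -/
theorem IsCoordFinsler.forall_isUnitNormal_iff (hL : IsCoordFinsler Ω L)
    (h : (u, v) ∈ coordLineElements U X Ω) (φ : (Fin n → ℝ) →ₗ[ℝ] ℝ) :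
    (∀ N, IsUnitNormal L X u v N → φ N = 0) ↔
      ∀ N, (proj X u)ᵀ *ᵥ (metric L (X u) (support X u v) *ᵥ N) = 0 → φ N = 0 := by
  constructor
  · intro H N hN
    by_cases h0 : N = 0
    · rw [h0, map_zero]
    have hpos := mulVec_dotProduct_self_pos (hL.posDef _ _ h.2) h0
    set s := (metric L (X u) (support X u v) *ᵥ N) ⬝ᵥ N
    have h1 : IsUnitNormal L X u v ((√s)⁻¹ • N) := by
      refine ⟨isNormal_iff.2 ?_, ?_⟩
      · rw [Matrix.mulVec_smul, Matrix.mulVec_smul, hN, smul_zero]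
      · rw [sum_metric_eq, Matrix.mulVec_smul, smul_dotProduct, dotProduct_smul, smul_eq_mul,
          smul_eq_mul, ← mul_assoc, ← mul_inv, Real.mul_self_sqrt hpos.le,
          inv_mul_cancel₀ hpos.ne']
    have h2 := H _ h1
    rw [map_smul, smul_eq_mul] at h2
    exact (mul_eq_zero.1 h2).resolve_left (inv_ne_zero (Real.sqrt_ne_zero'.2 hpos))
  · exact fun H N hN => H N (isNormal_iff.1 hN.1)

/-- `H_0` vanishes at a line element if and only if the normal part of the relative acceleration
does. -/
theorem IsCoordImmersion.normalCurvature₀_eq_zero_iff (hX : IsCoordImmersion U X)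
    (hL : IsCoordFinsler Ω L) (h : (u, v) ∈ coordLineElements U X Ω) :
    (∀ N, IsUnitNormal L X u v N → normalCurvature₀ L X N u v = 0) ↔
      normalPart (metric L (X u) (support X u v)) (proj X u) (gaussVec L X u v) = 0 := by
  have h1 : ∀ N, normalCurvature₀ L X N u v
      = (dotProductBilin ℝ ℝ (gaussVec L X u v) ∘ₗ
        (metric L (X u) (support X u v)).mulVecLin) N := fun N => by
    rw [normalCurvature₀_eq, dotProduct_comm]; rfl
  simp only [h1]
  rw [hL.forall_isUnitNormal_iff h,
    normalPart_eq_zero_iff (hL.posDef _ _ h.2) (hX.proj_injective h.1)]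
  simp only [← h1, normalCurvature₀_eq]

theorem IsCoordImmersion.inducedConn_mul (hX : IsCoordImmersion U X)
    (hL : IsCoordFinsler Ω L) (h : (u, v) ∈ coordLineElements U X Ω) :
    (fun α => ∑ β, inducedConn L X α β u v * v β) =
      ((proj X u)ᵀ * metric L (X u) (support X u v) * proj X u)⁻¹ *ᵥ
        ((proj X u)ᵀ *ᵥ (metric L (X u) (support X u v) *ᵥ gaussVec L X u v)) := by
  have h1 : ∀ α i, projInv L X α i u v
      = (((proj X u)ᵀ * metric L (X u) (support X u v) * proj X u)⁻¹ * (proj X u)ᵀ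
        * metric L (X u) (support X u v)) α i := fun α i => by
    simp only [projInv, metricInv, hX.metric_inducedL hL h]
    rw [Matrix.mul_assoc _ _ (metric L (X u) (support X u v)), Matrix.mul_apply]
    refine Finset.sum_congr rfl fun β _ => ?_
    rw [Matrix.mul_apply, Finset.mul_sum]
    refine Finset.sum_congr rfl fun j _ => ?_
    rw [hL.metric_symm h.2 i j, Matrix.transpose_apply]; ring
  funext α
  rw [Matrix.mulVec_mulVec, Matrix.mulVec_mulVec]
  simp only [inducedConn, h1, Matrix.mulVec, dotProduct, gaussVec, Finset.sum_mul, Finset.mul_sum]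
  rw [Finset.sum_comm]
  simp only [mul_assoc]

end Hypersurface

/-! ### Paths of the induced connection -/

section Paths

variable {n m : ℕ} {Ω : Set ((Fin n → ℝ) × (Fin n → ℝ))} {L K : Scalar n}
  {U : Set (Fin m → ℝ)} {X : (Fin m → ℝ) → (Fin n → ℝ)} {u v : Fin m → ℝ}

theorem IsCoordImmersion.hasDerivAt_comp (hX : IsCoordImmersion U X) {c : ℝ → (Fin m → ℝ)} {t : ℝ}
    (hc : DifferentiableAt ℝ c t) (hu : c t ∈ U) :
    HasDerivAt (X ∘ c) (support X (c t) (deriv c t)) t := by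
  rw [support_eq]
  exact ((hX.smooth.contDiffAt (hX.isOpen.mem_nhds hu)).differentiableAt
    (by simp)).hasFDerivAt.comp_hasDerivAt t hc.hasDerivAt

/-- The acceleration `B^i_βα c'^β c'^α + B^i_α c''^α` of a curve on the hypersurface. -/
theorem IsCoordImmersion.hasDerivAt_deriv_comp (hX : IsCoordImmersion U X)
    {c : ℝ → (Fin m → ℝ)} {t : ℝ} {a : Fin m → ℝ}
    (hc : ∀ᶠ τ in nhds t, DifferentiableAt ℝ c τ ∧ c τ ∈ U) (ha : HasDerivAt (deriv c) a t) :
    HasDerivAt (deriv (X ∘ c))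
      (fun i => (∑ α, ∑ β, proj₂ X (c t) i β α * deriv c t β * deriv c t α)
        + (proj X (c t) *ᵥ a) i) t := by
  have h1 : deriv (X ∘ c) =ᶠ[nhds t] fun τ => support X (c τ) (deriv c τ) := by
    filter_upwards [hc] with τ hτ using (hX.hasDerivAt_comp hτ.1 hτ.2).deriv
  obtain ⟨hd, hu⟩ := hc.self_of_nhds
  refine HasDerivAt.congr_of_eventuallyEq ?_ h1
  refine hasDerivAt_pi.2 fun i => ?_
  have h2 : ∀ α, HasDerivAt (fun τ => proj X (c τ) i α)
      (∑ β, proj₂ X (c t) i α β * deriv c t β) t := fun α => by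
    have h3 := (((hX.contDiffOn_proj i α).contDiffAt (hX.isOpen.mem_nhds hu)).differentiableAt
      (by simp)).hasFDerivAt.comp_hasDerivAt t hd.hasDerivAt
    convert! h3 using 1
    conv_rhs => rw [pi_eq_sum_univ' (deriv c t), map_sum]
    simp only [map_smul, smul_eq_mul]
    exact Finset.sum_congr rfl fun β _ => mul_comm _ _
  have h4 := HasDerivAt.fun_sum (u := Finset.univ)
    fun α _ => (h2 α).fun_mul (hasDerivAt_pi.1 ha α)
  convert! h4 using 1
  rw [Finset.sum_add_distrib]
  congr 1
  rw [Finset.sum_comm]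
  refine Finset.sum_congr rfl fun α _ => ?_
  rw [Finset.sum_mul]
  exact Finset.sum_congr rfl fun β _ => by ring

/-- Along a path of the induced connection, the ambient path equation fails exactly by the normal
part of the relative acceleration. -/
theorem IsCoordImmersion.hasDerivAt_deriv_comp_path (hX : IsCoordImmersion U X)
    (hL : IsCoordFinsler Ω L) {a b : ℝ} {c : ℝ → (Fin m → ℝ)}
    (hc : IsPath (coordLineElements U X Ω) (inducedConn L X) a b c) {t : ℝ}
    (ht : t ∈ Set.Ioo a b) :
    HasDerivAt (deriv (X ∘ c))
      ((fun i => -∑ j, nonlinConn L i j (X (c t)) (support X (c t) (deriv c t))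
          * support X (c t) (deriv c t) j)
        + normalPart (metric L (X (c t)) (support X (c t) (deriv c t))) (proj X (c t))
          (gaussVec L X (c t) (deriv c t))) t := by
  obtain ⟨-, hmem, hacc⟩ := hc t ht
  have hev : ∀ᶠ τ in nhds t, DifferentiableAt ℝ c τ ∧ c τ ∈ U := by
    filter_upwards [Ioo_mem_nhds ht.1 ht.2] with τ hτ
    exact ⟨(hc τ hτ).1, (hc τ hτ).2.1.1⟩
  have h1 := hX.hasDerivAt_deriv_comp hev hacc
  have h2 : (fun α => -∑ β, inducedConn L X α β (c t) (deriv c t) * deriv c t β)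
      = -(fun α => ∑ β, inducedConn L X α β (c t) (deriv c t) * deriv c t β) := rfl
  rw [h2, hX.inducedConn_mul hL hmem, Matrix.mulVec_neg] at h1
  convert! h1 using 1
  funext i
  simp only [normalPart, Pi.add_apply, Pi.sub_apply, Pi.neg_apply, gaussVec_apply]
  ring

/-- Through every line element of the hypersurface there passes a path of the induced
connection. -/
theorem IsCoordImmersion.exists_isPath (hX : IsCoordImmersion U X) (hL : IsCoordFinsler Ω L)
    (h : (u, v) ∈ coordLineElements U X Ω) :
    ∃ (a b : ℝ) (c : ℝ → (Fin m → ℝ)),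
      IsPath (coordLineElements U X Ω) (inducedConn L X) a b c ∧ (0 : ℝ) ∈ Set.Ioo a b ∧
        c 0 = u ∧ deriv c 0 = v := by
  have hΛ := hX.isOpen_coordLineElements hL.isOpen
  set V : (Fin m → ℝ) × (Fin m → ℝ) → (Fin m → ℝ) × (Fin m → ℝ) :=
    fun z => (z.2, fun α => -∑ β, inducedConn L X α β z.1 z.2 * z.2 β) with hV
  have hVs : ContDiffOn ℝ ∞ V (coordLineElements U X Ω) :=
    contDiffOn_snd.prodMk (contDiffOn_pi.2 fun α => ContDiffOn.neg
      (SmoothScalarOn.sum fun β _ => (hX.smooth_inducedConn hL α β).mul (smoothScalarOn_coord β)))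
  have hV1 : ContDiffAt ℝ 1 V (u, v) :=
    (hVs.contDiffAt (hΛ.mem_nhds h)).of_le (WithTop.coe_le_coe.2 le_top)
  obtain ⟨γ, hγ0, ε, hε, hγ⟩ :=
    hV1.exists_forall_mem_closedBall_exists_eq_forall_mem_Ioo_hasDerivAt₀ 0
  have hε0 : (0 : ℝ) ∈ Set.Ioo (0 - ε) (0 + ε) := by constructor <;> linarith
  have hev : ∀ᶠ τ in nhds (0 : ℝ), HasDerivAt γ (V (γ τ)) τ ∧ γ τ ∈ coordLineElements U X Ω := by
    have hcont := (hγ 0 hε0).continuousAt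
    filter_upwards [Ioo_mem_nhds hε0.1 hε0.2,
      hcont.preimage_mem_nhds (hΛ.mem_nhds (by rwa [hγ0]))] with τ h1 h2 using ⟨hγ τ h1, h2⟩
  obtain ⟨a, b, hab, hsub⟩ := mem_nhds_iff_exists_Ioo_subset.1 hev
  have h1 : ∀ τ ∈ Set.Ioo a b, HasDerivAt (fun τ => (γ τ).1) (γ τ).2 τ := fun τ hτ =>
    (hasFDerivAt_fst.comp_hasDerivAt τ (hsub hτ).1 :)
  have h2 : ∀ τ ∈ Set.Ioo a b, deriv (fun τ => (γ τ).1) τ = (γ τ).2 :=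
    fun τ hτ => (h1 τ hτ).deriv
  refine ⟨a, b, fun τ => (γ τ).1, fun τ hτ => ⟨(h1 τ hτ).differentiableAt, ?_, ?_⟩, hab, ?_, ?_⟩
  · rw [h2 τ hτ]; exact (hsub hτ).2
  · have h3 : HasDerivAt (fun τ => (γ τ).2) (V (γ τ)).2 τ :=
      (hasFDerivAt_snd.comp_hasDerivAt τ (hsub hτ).1 :)
    rw [h2 τ hτ]
    refine h3.congr_of_eventuallyEq ?_
    filter_upwards [Ioo_mem_nhds hτ.1 hτ.2] with s hs using h2 s hs
  · simp [hγ0]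
  · rw [h2 0 hab, hγ0]

/-- Over a coordinate patch, all paths of the hypersurface are ambient paths if and only if `H_0`
vanishes. -/
theorem IsCoordImmersion.forall_isPath_iff (hX : IsCoordImmersion U X)
    (hL : IsCoordFinsler Ω L) :
    (∀ (a b : ℝ) (c : ℝ → (Fin m → ℝ)),
      IsPath (coordLineElements U X Ω) (inducedConn L X) a b c →
      IsPath Ω (nonlinConn L) a b (X ∘ c)) ↔
    ∀ z ∈ coordLineElements U X Ω, ∀ N, IsUnitNormal L X z.1 z.2 N →
      normalCurvature₀ L X N z.1 z.2 = 0 := by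
  constructor
  · rintro H ⟨u, v⟩ h
    refine (hX.normalCurvature₀_eq_zero_iff hL h).2 ?_
    obtain ⟨a, b, c, hc, h0, rfl, rfl⟩ := hX.exists_isPath hL h
    have h1 := hX.hasDerivAt_deriv_comp_path hL hc h0
    have h2 := (H a b c hc 0 h0).2.2
    rw [(hX.hasDerivAt_comp (hc 0 h0).1 h.1).deriv] at h2
    exact add_eq_left.1 (h1.unique h2)
  · intro H a b c hc t ht
    obtain ⟨hd, hmem, -⟩ := hc t ht
    have h1 := hX.hasDerivAt_comp hd hmem.1
    refine ⟨h1.differentiableAt, ?_, ?_⟩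
    · rw [h1.deriv]; exact hmem.2
    · have h2 := hX.hasDerivAt_deriv_comp_path hL hc ht
      rw [(hX.normalCurvature₀_eq_zero_iff hL hmem).1 (H (c t, deriv c t) hmem), add_zero] at h2
      rw [h1.deriv]
      exact h2

/-! ### Invariance of `H_0 = 0` under the Kropina change -/

/-- If `b` is a gradient h-vector tangent to the hypersurface, `H_0` and `*H_0` vanish at the same
line elements: the normals of both metrics agree, and the difference of the two sprays is orthogonal
to them for the metric tensor of the Kropina change. -/
theorem IsCoordImmersion.normalCurvature₀_kropina (hX : IsCoordImmersion U X)
    {b : (Fin n → ℝ) → (Fin n → ℝ) → Fin n → ℝ} {ρ : Scalar n}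
    (hL : IsCoordFinsler Ω L) (hK : IsCoordFinsler Ω K) (hb : IsCoordHVector Ω L b ρ)
    (hβ : ∀ x y, (x, y) ∈ Ω → pairing b x y ≠ 0)
    (hKL : ∀ x y, (x, y) ∈ Ω → K x y = L x y ^ 2 / pairing b x y)
    (h : (u, v) ∈ coordLineElements U X Ω)
    (hgrad : ∀ i j, hCov L b i j (X u) (support X u v) = hCov L b j i (X u) (support X u v))
    (htan : ∀ N, IsUnitNormal L X u v N → ∑ i, b (X u) (support X u v) i * N i = 0) :
    (∀ N, IsUnitNormal L X u v N → normalCurvature₀ L X N u v = 0) ↔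
      ∀ N, IsUnitNormal K X u v N → normalCurvature₀ K X N u v = 0 := by
  rw [hX.normalCurvature₀_eq_zero_iff hL h, hX.normalCurvature₀_eq_zero_iff hK h,
    normalPart_eq_zero_iff (hL.posDef _ _ h.2) (hX.proj_injective h.1),
    normalPart_eq_zero_iff (hK.posDef _ _ h.2) (hX.proj_injective h.1)]
  set x := X u with hx
  set y := support X u v with hy
  have hxy : (x, y) ∈ Ω := h.2
  have htan' : ∀ N, (proj X u)ᵀ *ᵥ (metric L x y *ᵥ N) = 0 → ∑ i, b x y i * N i = 0 :=
    (hL.forall_isUnitNormal_iff h (dotProductBilin ℝ ℝ (b x y))).1 htan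
  -- A normal is orthogonal to `yⁱ = B^i_α v^α`, which lowers to `½ ∂L²/∂yⁱ`.
  have hP : ∀ N, (proj X u)ᵀ *ᵥ (metric L x y *ᵥ N) = 0 →
      ∑ i, dY i (sqL L) x y * N i = 0 := fun N hN => by
    have h1 : (metric L x y *ᵥ y) ⬝ᵥ N = 0 := by
      rw [mulVec_dotProduct_comm (hL.isSymm_metric hxy)]
      change (metric L x y *ᵥ N) ⬝ᵥ (proj X u *ᵥ v) = 0
      rw [Matrix.dotProduct_mulVec, ← Matrix.mulVec_transpose, hN, zero_dotProduct]
    simp only [dotProduct, hL.metric_mulVec hxy, mul_assoc, ← Finset.mul_sum] at h1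
    simpa using h1
  obtain ⟨κ, hκ⟩ := exists_metric_kropina_mulVec hL hK hb hβ hKL hxy
  have hκ' : ∀ N, (proj X u)ᵀ *ᵥ (metric L x y *ᵥ N) = 0 →
      metric K x y *ᵥ N = κ • (metric L x y *ᵥ N) := fun N hN => hκ N (hP N hN) (htan' N hN)
  have hnorm : ∀ N, (proj X u)ᵀ *ᵥ (metric K x y *ᵥ N) = 0 →
      (proj X u)ᵀ *ᵥ (metric L x y *ᵥ N) = 0 := fun N hN =>
    normal_of_normal (hL.posDef _ _ hxy) (hK.posDef _ _ hxy) (hX.proj_injective h.1) hκ' hN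
  obtain ⟨σ, τ, hστ⟩ := exists_eulerLagrange_sqL_kropina hL hK hb hβ hKL hxy hgrad
  set D : Fin n → ℝ := fun s => sprayCoeff K s x y - sprayCoeff L s x y with hD
  have hw : gaussVec K X u v = gaussVec L X u v + (2 : ℝ) • D := by
    funext i
    simp only [Pi.add_apply, Pi.smul_apply, gaussVec_apply, hL.nonlinConn_mul h.2,
      hK.nonlinConn_mul h.2, smul_eq_mul, hD, hx, hy]
    ring
  have hDN : ∀ N, (proj X u)ᵀ *ᵥ (metric L x y *ᵥ N) = 0 → (metric K x y *ᵥ N) ⬝ᵥ D = 0 :=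
    fun N hN => by
      have h1 : 4 * ((metric K x y *ᵥ D) ⬝ᵥ N) = 0 := by
        calc 4 * ((metric K x y *ᵥ D) ⬝ᵥ N)
            = ∑ i, (σ * dY i (sqL L) x y + τ * b x y i) * N i := by
              rw [dotProduct, Finset.mul_sum]
              refine Finset.sum_congr rfl fun i _ => ?_
              rw [← hστ i, hK.eulerLagrange_sqL_eq L hxy i, mul_assoc]
          _ = σ * ∑ i, dY i (sqL L) x y * N i + τ * ∑ i, b x y i * N i := by
              simp only [add_mul, Finset.sum_add_distrib, Finset.mul_sum, mul_assoc]
          _ = 0 := by rw [hP N hN, htan' N hN]; ring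
      rw [mulVec_dotProduct_comm (hK.isSymm_metric hxy)]
      linarith
  have key : ∀ N, (proj X u)ᵀ *ᵥ (metric L x y *ᵥ N) = 0 →
      (metric K x y *ᵥ N) ⬝ᵥ gaussVec K X u v
        = κ * ((metric L x y *ᵥ N) ⬝ᵥ gaussVec L X u v) := fun N hN => by
    rw [hw, dotProduct_add, dotProduct_smul, hDN N hN, hκ' N hN, smul_dotProduct]
    simp
  constructor
  · intro H N hN
    rw [key N (hnorm N hN), H N (hnorm N hN), mul_zero]
  · intro H N hN
    have hN' : (proj X u)ᵀ *ᵥ (metric K x y *ᵥ N) = 0 := by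
      rw [hκ' N hN, Matrix.mulVec_smul, hN, smul_zero]
    have h1 := H N hN'
    rw [key N hN] at h1
    refine (mul_eq_zero.1 h1).elim (fun hκ0 => ?_) id
    -- If `κ = 0` then `N` is null for the positive definite `*g`, hence zero.
    have hN0 : N = 0 := by
      by_contra hne
      have := mulVec_dotProduct_self_pos (hK.posDef _ _ hxy) hne
      rw [hκ' N hN, hκ0, zero_smul, zero_dotProduct] at this
      exact lt_irrefl _ this
    rw [hN0, Matrix.mulVec_zero, zero_dotProduct]

end Paths

/-! ### Passage to coordinates on a manifold -/

section Manifolds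

variable {n m : ℕ}
  {M : Type*} [TopologicalSpace M] [ChartedSpace (Fin n → ℝ) M]
  {S : Type*} [TopologicalSpace S] [ChartedSpace (Fin m → ℝ) S]
  {D : Set (TangentBundle 𝓘(ℝ, Fin n → ℝ) M)} {L : TangentBundle 𝓘(ℝ, Fin n → ℝ) M → ℝ}

theorem coordVec_smul (p : M) (x y : Fin n → ℝ) (c : ℝ) :
    coordVec p x (c • y) = ⟨(coordVec p x y).1, c • (coordVec p x y).2⟩ := by
  have h : (coordVec p x (c • y)).2 = c • (coordVec p x y).2 :=
    map_smul (mfderiv 𝓘(ℝ, Fin n → ℝ) 𝓘(ℝ, Fin n → ℝ)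
      (extChartAt 𝓘(ℝ, Fin n → ℝ) p).symm x) c y
  rw [← h]; rfl

theorem pairing_coordCovec (b : CovectorField n M) (p : M) (x y : Fin n → ℝ) :
    pairing (coordCovec b p) x y = b (coordVec p x y) (coordVec p x y).2 := by
  let T : (Fin n → ℝ) →L[ℝ] (Fin n → ℝ) :=
    mfderiv 𝓘(ℝ, Fin n → ℝ) 𝓘(ℝ, Fin n → ℝ) (extChartAt 𝓘(ℝ, Fin n → ℝ) p).symm x
  let ψ : (Fin n → ℝ) →L[ℝ] ℝ := b (coordVec p x y)
  change ∑ i, ψ (T (Pi.single i 1)) * y i = ψ (T y)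
  conv_rhs => rw [pi_eq_sum_univ' y, map_sum, map_sum]
  simp only [map_smul, smul_eq_mul, mul_comm]

theorem coordFun_kropina (b : CovectorField n M) (p : M) (x y : Fin n → ℝ) :
    coordFun (kropina L b) p x y = coordFun L p x y ^ 2 / pairing (coordCovec b p) x y := by
  rw [pairing_coordCovec]; rfl

variable [IsManifold 𝓘(ℝ, Fin n → ℝ) ∞ M]

theorem contMDiffOn_coordVec (p : M) :
    ContMDiffOn 𝓘(ℝ, (Fin n → ℝ) × (Fin n → ℝ)) 𝓘(ℝ, Fin n → ℝ).tangent ∞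
      (fun z : (Fin n → ℝ) × (Fin n → ℝ) => coordVec p z.1 z.2)
      ((extChartAt 𝓘(ℝ, Fin n → ℝ) p).target ×ˢ Set.univ) := by
  have hT : IsOpen (extChartAt 𝓘(ℝ, Fin n → ℝ) p).target := isOpen_extChartAt_target p
  have h1 := (contMDiffOn_extChartAt_symm (I := 𝓘(ℝ, Fin n → ℝ)) (n := ∞)
    p).contMDiffOn_tangentMapWithin (m := ∞) (by simp) hT.uniqueMDiffOn
  have h2 : ContMDiff 𝓘(ℝ, Fin n → ℝ).tangent 𝓘(ℝ, Fin n → ℝ).tangent ∞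
      ((tangentBundleModelSpaceHomeomorph 𝓘(ℝ, Fin n → ℝ)).symm :
        ModelProd (Fin n → ℝ) (Fin n → ℝ) → TangentBundle 𝓘(ℝ, Fin n → ℝ) (Fin n → ℝ)) :=
    contMDiff_tangentBundleModelSpaceHomeomorph_symm
  -- Typed as a set in `ModelProd`, so that the charted space structures agree.
  let s : Set (ModelProd (Fin n → ℝ) (Fin n → ℝ)) :=
    {z | z.1 ∈ (extChartAt 𝓘(ℝ, Fin n → ℝ) p).target}
  have h3 := h1.comp (h2.contMDiffOn (s := s)) fun z hz => hz
  rw [modelWithCornersSelf_prod]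
  have hs : (extChartAt 𝓘(ℝ, Fin n → ℝ) p).target ×ˢ Set.univ = s :=
    Set.ext fun _ => ⟨And.left, fun h => ⟨h, trivial⟩⟩
  rw [hs]
  refine ContMDiffOn.congr h3 fun z hz => ?_
  change _ = tangentMapWithin _ _ _ _ ⟨z.1, z.2⟩
  rw [coordVec, tangentMapWithin_eq_tangentMap]
  · exact hT.uniqueMDiffWithinAt hz
  · exact ((contMDiffOn_extChartAt_symm (I := 𝓘(ℝ, Fin n → ℝ)) (n := ∞)
      p).contMDiffAt (hT.mem_nhds hz)).mdifferentiableAt (by simp)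

theorem isOpen_coordDomain (hD : IsOpen D) (p : M) : IsOpen (coordDomain D p) := by
  have := (contMDiffOn_coordVec p).continuousOn.isOpen_inter_preimage
    ((isOpen_extChartAt_target p).prod isOpen_univ) hD
  have e : coordDomain D p = (extChartAt 𝓘(ℝ, Fin n → ℝ) p).target ×ˢ Set.univ ∩
      (fun z : (Fin n → ℝ) × (Fin n → ℝ) => coordVec p z.1 z.2) ⁻¹' D := by
    ext z
    simp [coordDomain]
  rwa [e]

/-- A Finsler metric on a manifold is one in each coordinate system. -/
theorem IsFinslerMetric.isCoordFinsler (hL : IsFinslerMetric D L) (p : M) :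
    IsCoordFinsler (coordDomain D p) (coordFun L p) where
  isOpen := isOpen_coordDomain hL.isOpen p
  smooth := by
    have h : ContMDiffOn 𝓘(ℝ, (Fin n → ℝ) × (Fin n → ℝ)) 𝓘(ℝ, ℝ) ∞
        (L ∘ fun z : (Fin n → ℝ) × (Fin n → ℝ) => coordVec p z.1 z.2) (coordDomain D p) :=
      hL.smooth.comp ((contMDiffOn_coordVec p).mono fun z hz => ⟨hz.1, trivial⟩) fun z hz => hz.2
    exact h.contDiffOn
  pos := fun x y h => hL.pos _ h.2
  homog := fun x y h c hc => by
    rw [coordFun, coordVec_smul, hL.homog _ h.2 c hc, pow_one]; rfl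
  posDef := fun x y h => hL.posDef p (x, y) h

variable [IsManifold 𝓘(ℝ, Fin m → ℝ) ∞ S] {φ : S → M}

theorem IsImmersedHypersurface.isCoordImmersion
    (hφ : IsImmersedHypersurface m n φ) (s : S) :
    IsCoordImmersion (patchDomain (m := m) n φ s) (patch (m := m) (n := n) φ s) := by
  have hT : IsOpen (extChartAt 𝓘(ℝ, Fin m → ℝ) s).target := isOpen_extChartAt_target s
  have hsymm : ContMDiffOn 𝓘(ℝ, Fin m → ℝ) 𝓘(ℝ, Fin m → ℝ) ∞ (extChartAt 𝓘(ℝ, Fin m → ℝ) s).symm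
    (extChartAt 𝓘(ℝ, Fin m → ℝ) s).target := contMDiffOn_extChartAt_symm s
  have h1 : ContMDiffOn 𝓘(ℝ, Fin m → ℝ) 𝓘(ℝ, Fin n → ℝ) ∞
      (φ ∘ (extChartAt 𝓘(ℝ, Fin m → ℝ) s).symm) (extChartAt 𝓘(ℝ, Fin m → ℝ) s).target :=
    hφ.1.comp_contMDiffOn hsymm
  have hopen : IsOpen (patchDomain (m := m) n φ s) :=
    h1.continuousOn.isOpen_inter_preimage hT (isOpen_extChartAt_source (φ s))
  have hsmooth : ContMDiffOn 𝓘(ℝ, Fin m → ℝ) 𝓘(ℝ, Fin n → ℝ) ∞ (patch (m := m) (n := n) φ s)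
      (patchDomain (m := m) n φ s) := by
    refine ContMDiffOn.comp (t := (chartAt (Fin n → ℝ) (φ s)).source)
      contMDiffOn_extChartAt (h1.mono fun u hu => hu.1) fun u hu => ?_
    have := hu.2
    rwa [extChartAt_source] at this
  refine ⟨hopen, hsmooth.contDiffOn, fun u hu => ?_⟩
  have d1 := (hsymm.contMDiffAt (hT.mem_nhds hu.1)).mdifferentiableAt (by simp)
  have d2 := (hφ.1 ((extChartAt 𝓘(ℝ, Fin m → ℝ) s).symm u)).mdifferentiableAt (by simp)
  have hu2 : φ ((extChartAt 𝓘(ℝ, Fin m → ℝ) s).symm u) ∈ (chartAt (Fin n → ℝ) (φ s)).source := by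
    have := hu.2
    rwa [extChartAt_source] at this
  have d3 : MDifferentiableAt 𝓘(ℝ, Fin n → ℝ) 𝓘(ℝ, Fin n → ℝ) (extChartAt 𝓘(ℝ, Fin n → ℝ) (φ s))
    (φ ((extChartAt 𝓘(ℝ, Fin m → ℝ) s).symm u)) := mdifferentiableAt_extChartAt hu2
  have e : fderiv ℝ (patch φ s) u
      = (mfderiv 𝓘(ℝ, Fin n → ℝ) 𝓘(ℝ, Fin n → ℝ) (extChartAt 𝓘(ℝ, Fin n → ℝ) (φ s))
          (φ ((extChartAt 𝓘(ℝ, Fin m → ℝ) s).symm u))).comp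
        ((mfderiv 𝓘(ℝ, Fin m → ℝ) 𝓘(ℝ, Fin n → ℝ) φ ((extChartAt 𝓘(ℝ, Fin m → ℝ) s).symm u)).comp
        (mfderiv 𝓘(ℝ, Fin m → ℝ) 𝓘(ℝ, Fin m → ℝ) (extChartAt 𝓘(ℝ, Fin m → ℝ) s).symm u)) := by
    rw [← mfderiv_eq_fderiv]
    have := (d3.hasMFDerivAt.comp u (d2.hasMFDerivAt.comp u d1.hasMFDerivAt)).mfderiv
    exact this
  have i1 : Function.Injective (mfderiv 𝓘(ℝ, Fin m → ℝ) 𝓘(ℝ, Fin m → ℝ)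
      (extChartAt 𝓘(ℝ, Fin m → ℝ) s).symm u) := by
    have := isInvertible_mfderivWithin_extChartAt_symm (I := 𝓘(ℝ, Fin m → ℝ)) hu.1
    rw [modelWithCornersSelf_coe, Set.range_id, mfderivWithin_univ] at this
    exact this.bijective.injective
  have i3 : Function.Injective (mfderiv 𝓘(ℝ, Fin n → ℝ) 𝓘(ℝ, Fin n → ℝ)
      (extChartAt 𝓘(ℝ, Fin n → ℝ) (φ s)) (φ ((extChartAt 𝓘(ℝ, Fin m → ℝ) s).symm u))) :=
    (isInvertible_mfderiv_extChartAt hu.2).bijective.injective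
  rw [e]
  exact i3.comp ((hφ.2 _).comp i1)

theorem IsImmersedHypersurface.isHyperplaneFirstKind_iff 
    (hφ : IsImmersedHypersurface m n φ) (hL : IsFinslerMetric D L) :
    IsHyperplaneFirstKind m D L φ ↔ NormalCurvatureVanishes m D L φ :=
  forall_congr' fun s => (hφ.isCoordImmersion s).forall_isPath_iff (hL.isCoordFinsler (φ s))

theorem IsImmersedHypersurface.normalCurvatureVanishes_kropina_iff 
    {b : CovectorField n M} (hφ : IsImmersedHypersurface m n φ) (hL : IsFinslerMetric D L)
    (hb_smooth : IsSmoothCovectorField D b) (hb : IsHVector D L b)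
    (hK : IsFinslerMetric D (kropina L b)) (hgrad : IsGradient D L b)
    (htan : IsTangentTo m D L b φ) :
    NormalCurvatureVanishes m D L φ ↔ NormalCurvatureVanishes m D (kropina L b) φ := by
  obtain ⟨ρ, -, hρ⟩ := hb
  have key : ∀ (s : S) (u v : Fin m → ℝ), (u, v) ∈ lineElements D φ s →
      ((∀ N, IsUnitNormal (coordFun L (φ s)) (patch φ s) u v N →
          normalCurvature₀ (coordFun L (φ s)) (patch φ s) N u v = 0) ↔
        ∀ N, IsUnitNormal (coordFun (kropina L b) (φ s)) (patch φ s) u v N →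
          normalCurvature₀ (coordFun (kropina L b) (φ s)) (patch φ s) N u v = 0) := by
    intro s u v hz
    have hbs : IsCoordHVector (coordDomain D (φ s)) (coordFun L (φ s)) (coordCovec b (φ s))
        (fun x y => ρ (coordVec (φ s) x y)) :=
      { smooth := fun i => contDiffOn_pi.1 (hb_smooth (φ s)) i
        vCov_eq_zero := fun x y h => (hρ (φ s) (x, y) h).1
        cartan := fun x y h => (hρ (φ s) (x, y) h).2 }
    have hβ : ∀ x y, (x, y) ∈ coordDomain D (φ s) → pairing (coordCovec b (φ s)) x y ≠ 0 := by
      intro x y h h0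
      -- `*L = L²/β` is positive, whereas a vanishing `β` would give it the value `0`.
      have h1 := (hK.isCoordFinsler (φ s)).pos x y h
      rw [coordFun_kropina, h0, div_zero] at h1
      exact lt_irrefl _ h1
    exact (hφ.isCoordImmersion s).normalCurvature₀_kropina (hL.isCoordFinsler (φ s))
      (hK.isCoordFinsler (φ s)) hbs hβ (fun x y _ => coordFun_kropina b (φ s) x y)
      hz (hgrad (φ s) (patch φ s u, support (patch φ s) u v) hz.2) (htan s (u, v) hz)
  exact ⟨fun H s z hz => (key s z.1 z.2 hz).1 (H s z hz),
    fun H s z hz => (key s z.1 z.2 hz).2 (H s z hz)⟩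

end Manifolds

end FinslerHypersurface

theorem mainTheorem2 {m : ℕ}
    {M : Type*} [TopologicalSpace M] [ChartedSpace (Fin (m + 1) → ℝ) M]
    [IsManifold 𝓘(ℝ, Fin (m + 1) → ℝ) ∞ M]
    {S : Type*} [TopologicalSpace S] [ChartedSpace (Fin m → ℝ) S]
    [IsManifold 𝓘(ℝ, Fin m → ℝ) ∞ S]
    (D : Set (TangentBundle 𝓘(ℝ, Fin (m + 1) → ℝ) M))
    (L : TangentBundle 𝓘(ℝ, Fin (m + 1) → ℝ) M → ℝ)
    (hL : FinslerHypersurface.IsFinslerMetric D L)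
    (b : FinslerHypersurface.CovectorField (m + 1) M)
    (hb_smooth : FinslerHypersurface.IsSmoothCovectorField D b)
    (hb : FinslerHypersurface.IsHVector D L b)
    (hK : FinslerHypersurface.IsFinslerMetric D (FinslerHypersurface.kropina L b))
    (φ : S → M) (hφ : FinslerHypersurface.IsImmersedHypersurface m (m + 1) φ)
    (hgrad : FinslerHypersurface.IsGradient D L b)
    (htan : FinslerHypersurface.IsTangentTo m D L b φ) :
    (FinslerHypersurface.IsHyperplaneFirstKind m D L φ ↔
      FinslerHypersurface.IsHyperplaneFirstKind m D (FinslerHypersurface.kropina L b) φ) ∧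
    (FinslerHypersurface.IsHyperplaneFirstKind m D L φ ↔
      FinslerHypersurface.NormalCurvatureVanishes m D L φ) ∧
    (FinslerHypersurface.IsHyperplaneFirstKind m D (FinslerHypersurface.kropina L b) φ ↔
      FinslerHypersurface.NormalCurvatureVanishes m D (FinslerHypersurface.kropina L b) φ) := by
  have h1 := hφ.isHyperplaneFirstKind_iff hL
  have h2 := hφ.isHyperplaneFirstKind_iff hK
  have h3 := hφ.normalCurvatureVanishes_kropina_iff hL hb_smooth hb hK hgrad htan
  exact ⟨(h1.trans h3).trans h2.symm, h1, h2⟩
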